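/- Let $M$ be a smooth time-oriented manifold of dimension $n>2$ with a smooth metric $g_{\alpha\beta}$ of signature $(-,+,\dots,+)$ and Levi-Civita connection $\nabla$, and let $N$ be a (smoothly immersed, in particular any embedded) $(n-1)$-dimensional submanifold of $M$. Assume: * $N$ is null: at every point the pullback $q_{ab}$ of $g_{\alpha\beta}$ to $N$ is degenerate. Let $L\subset TN$ be the line bundle of null directions; a null field is a smooth section $\ell$ of $L$ over an open subset of $N$. * $N$ is non-expanding: at every point of $N$ the expansion of some null field $\ell$ that is non-zero there vanishes, the expansion being the trace, with respect to the positive definite metric induced by $q_{ab}$ on $TN/L$, of the tensor induced on $TN/L$ by the pullback of $\nabla_\beta\ell_\alpha$ to $N$. * At the points of $N$ the Einstein equations $G_{\alpha\beta}=-\Lambda g_{\alpha\beta}+T_{\alpha\beta}$ hold, with a constant $\Lambda$ and a tensor field $T_{\alpha\beta}$, where $G_{\alpha\beta}$ is the Einstein tensor of $g$. * $T_{\alpha\beta}\ell^\alpha\ell^\beta\ge 0$ for every null vector $\ell$ tangent to $N$. * (Stronger Energy Condition) For every future-directed null vector $\ell$ tangent to $N$, the vector $-T^{\mu}{}_{\nu}\ell^{\nu}$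 is zero, or causal and future-directed. Then $\nabla_XY$ is tangent to $N$ for all vector fields $X,Y$ on open subsets of $N$, so that $D_XY:=\nabla_XY$ defines an induced covariant derivative $D$ on $N$. For every nowhere vanishing null field $\ell$ on an open subset of $N$ there is on that subset a unique 1-form $\omega^{(\ell)}$ with $D_a\ell^b=\omega^{(\ell)}_a\ell^b$ (the rotation 1-form potential); it is smooth, and with the surface gravity $\kappa^{(\ell)}=\ell^a\omega^{(\ell)}_a$ it satisfies $$\mathcal L_\ell\,\omega^{(\ell)}_a=D_a\kappa^{(\ell)} .$$ As a consequence, the rotation 2-form $\Omega=d\omega^{(\ell)}$ is independent of $\ell$, so that it is a smooth 2-form defined on all of $N$, and it satisfies $\ell^a\Omega_{ab}=0$ and $\mathcal L_\ell\Omega_{ab}=0$ for every null field $\ell$ on an open subset of $N$ (which may have zeros). -/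

import Mathlib

set_option maxSynthPendingDepth 3

open scoped Manifold ContDiff Topology

noncomputable section

namespace NullSurface

/-- The pullback `(v, w) ↦ b(Av, Aw)` of a bilinear form. -/
def pullForm {V W : Type*} [AddCommGroup V] [Module ℝ V] [TopologicalSpace V]
    [AddCommGroup W] [Module ℝ W] [TopologicalSpace W]
    (b : W →L[ℝ] W →L[ℝ] ℝ) (A : V →L[ℝ] W) : V →L[ℝ] V →L[ℝ] ℝ :=
  ContinuousLinearMap.precomp ℝ A ∘L b ∘L A

theorem pullForm_apply {V W : Type*} [AddCommGroup V] [Module ℝ V] [TopologicalSpace V]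
    [AddCommGroup W] [Module ℝ W] [TopologicalSpace W]
    (b : W →L[ℝ] W →L[ℝ] ℝ) (A : V →L[ℝ] W) (v w : V) : pullForm b A v w = b (A v) (A w) :=
  rfl

/-- Exchanging the last two arguments of a trilinear map: `(u, v, w) ↦ D(u, w, v)`. -/
def flipLast {E G : Type*} [NormedAddCommGroup E] [NormedSpace ℝ E]
    [NormedAddCommGroup G] [NormedSpace ℝ G] (D : E →L[ℝ] E →L[ℝ] E →L[ℝ] G) :
    E →L[ℝ] E →L[ℝ] E →L[ℝ] G :=
  ContinuousLinearMap.comp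
    ((ContinuousLinearMap.flipₗᵢ ℝ E E G).toContinuousLinearEquiv.toContinuousLinearMap) D

theorem flipLast_apply {E G : Type*} [NormedAddCommGroup E] [NormedSpace ℝ E]
    [NormedAddCommGroup G] [NormedSpace ℝ G] (D : E →L[ℝ] E →L[ℝ] E →L[ℝ] G) (u v w : E) :
    flipLast D u v w = D u w v :=
  rfl

/-! ### Lorentzian metrics, time orientations -/

section Spacetime

variable (E : Type*) [NormedAddCommGroup E] [NormedSpace ℝ E]
  (M : Type*) [TopologicalSpace M] [ChartedSpace E M] [IsManifold 𝓘(ℝ, E) ∞ M]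

/-- A smooth metric tensor of signature `(-,+,…,+)` on a manifold `M` (without boundary) modelled
on `E`: a smooth symmetric `(0,2)` tensor field such that every tangent space contains a vector
`v` with `g(v,v) < 0` on whose orthogonal complement `g` is positive definite. -/
structure LorentzMetric where
  /-- The bilinear form on each tangent space. -/
  val (x : M) : TangentSpace 𝓘(ℝ, E) x →L[ℝ] TangentSpace 𝓘(ℝ, E) x →L[ℝ] ℝ
  symm (x : M) (v w : TangentSpace 𝓘(ℝ, E) x) : val x v w = val x w v
  signature (x : M) : ∃ v : TangentSpace 𝓘(ℝ, E) x, val x v v < 0 ∧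
    ∀ w : TangentSpace 𝓘(ℝ, E) x, val x v w = 0 → w ≠ 0 → 0 < val x w w
  contMDiff : ContMDiff 𝓘(ℝ, E) (𝓘(ℝ, E).prod 𝓘(ℝ, E →L[ℝ] E →L[ℝ] ℝ)) ∞
    (fun x ↦ Bundle.TotalSpace.mk' (E →L[ℝ] E →L[ℝ] ℝ)
      (E := fun x : M ↦ TangentSpace 𝓘(ℝ, E) x →L[ℝ] TangentSpace 𝓘(ℝ, E) x →L[ℝ] ℝ) x (val x))

variable {E M}

/-- A time orientation, given by a continuous timelike vector field. -/
structure TimeOrientation (g : LorentzMetric E M) where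
  /-- The timelike vector field, declared to be future directed. -/
  field (x : M) : TangentSpace 𝓘(ℝ, E) x
  timelike (x : M) : g.val x (field x) (field x) < 0
  continuous : Continuous (fun x ↦ (⟨x, field x⟩ : TangentBundle 𝓘(ℝ, E) M))

/-- The closed future cone: `v` is zero, or it is causal and future directed. -/
def IsFutureCausal {g : LorentzMetric E M} (τ : TimeOrientation g) {x : M}
    (v : TangentSpace 𝓘(ℝ, E) x) : Prop :=
  g.val x v v ≤ 0 ∧ g.val x (τ.field x) v ≤ 0

/-- Raising an index: the vector `v` with `g(v, ·) = α`. -/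
def raise (g : LorentzMetric E M) (x : M) (α : TangentSpace 𝓘(ℝ, E) x →L[ℝ] ℝ) :
    TangentSpace 𝓘(ℝ, E) x :=
  (g.val x).inverse α

/-! ### Levi-Civita connection and curvature in charts -/

/-- The components of the metric in the chart at `c`, as a function on the model space. -/
def chartMetric (g : LorentzMetric E M) (c : M) (y : E) : E →L[ℝ] E →L[ℝ] ℝ :=
  pullForm (g.val ((extChartAt 𝓘(ℝ, E) c).symm y))
    (mfderiv 𝓘(ℝ, E) 𝓘(ℝ, E) (extChartAt 𝓘(ℝ, E) c).symm y)

/-- Christoffel symbols with all indices down, in the chart at `c`: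
`(u, v, w) ↦ (∂_u g(v,w) + ∂_v g(u,w) - ∂_w g(u,v)) / 2`. -/
def christoffelLower (g : LorentzMetric E M) (c : M) (y : E) :
    E →L[ℝ] E →L[ℝ] E →L[ℝ] ℝ :=
  (2⁻¹ : ℝ) • (fderiv ℝ (chartMetric g c) y + (fderiv ℝ (chartMetric g c) y).flip
    - flipLast (fderiv ℝ (chartMetric g c) y).flip)

theorem christoffelLower_apply (g : LorentzMetric E M) (c : M) (y u v w : E) :
    christoffelLower g c y u v w = 2⁻¹ * (fderiv ℝ (chartMetric g c) y u v w
      + fderiv ℝ (chartMetric g c) y v u w - fderiv ℝ (chartMetric g c) y w u v) :=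
  rfl

/-- Christoffel symbols `Γ(u,v)` of the Levi-Civita connection in the chart at `c`. -/
def christoffel (g : LorentzMetric E M) (c : M) (y : E) : E →L[ℝ] E →L[ℝ] E :=
  ContinuousLinearMap.compL ℝ E (E →L[ℝ] ℝ) E (chartMetric g c y).inverse ∘L
    christoffelLower g c y

theorem christoffel_apply (g : LorentzMetric E M) (c : M) (y u v : E) :
    christoffel g c y u v = (chartMetric g c y).inverse (christoffelLower g c y u v) :=
  rfl

/-- Auxiliary: `(u, v, w) ↦ ∂_u Γ(v,w) + Γ(u, Γ(v,w))`. -/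
def chartRiemannAux (g : LorentzMetric E M) (c : M) (y : E) : E →L[ℝ] E →L[ℝ] E →L[ℝ] E :=
  fderiv ℝ (christoffel g c) y +
    (ContinuousLinearMap.compL ℝ E E E).bilinearComp (christoffel g c y) (christoffel g c y)

/-- The Riemann tensor `(u, v, w) ↦ R(u,v)w = [∇_u, ∇_v] w` in the chart at `c`. -/
def chartRiemann (g : LorentzMetric E M) (c : M) (y : E) : E →L[ℝ] E →L[ℝ] E →L[ℝ] E :=
  chartRiemannAux g c y - (chartRiemannAux g c y).flip

theorem chartRiemann_apply (g : LorentzMetric E M) (c : M) (y u v w : E) :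
    chartRiemann g c y u v w =
      (fderiv ℝ (christoffel g c) y u v w + christoffel g c y u (christoffel g c y v w))
      - (fderiv ℝ (christoffel g c) y v u w + christoffel g c y v (christoffel g c y u w)) :=
  rfl

variable [FiniteDimensional ℝ E]

/-- The Ricci tensor in the chart at `c`: `Ric(v,w)` is the trace of `u ↦ R(u,v)w`. -/
def chartRicci (g : LorentzMetric E M) (c : M) (y : E) : E →L[ℝ] E →L[ℝ] ℝ :=
  ContinuousLinearMap.compL ℝ E (E →L[ℝ] E) ℝ
      (LinearMap.toContinuousLinearMap
        (LinearMap.trace ℝ E ∘ₗ ContinuousLinearMap.coeLM ℝ)) ∘L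
    flipLast (chartRiemann g c y).flip

theorem chartRicci_apply (g : LorentzMetric E M) (c : M) (y v w : E) :
    chartRicci g c y v w =
      LinearMap.trace ℝ E (((chartRiemann g c y).flip v).flip w : E →L[ℝ] E) :=
  rfl

/-- The Ricci tensor of the spacetime. -/
def ricci (g : LorentzMetric E M) (x : M) :
    TangentSpace 𝓘(ℝ, E) x →L[ℝ] TangentSpace 𝓘(ℝ, E) x →L[ℝ] ℝ :=
  pullForm (chartRicci g x (extChartAt 𝓘(ℝ, E) x x))
    (mfderiv 𝓘(ℝ, E) 𝓘(ℝ, E) (extChartAt 𝓘(ℝ, E) x) x)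

/-- The scalar curvature `g^{αβ} Ric_{αβ}`. -/
def scalarCurvature (g : LorentzMetric E M) (x : M) : ℝ :=
  LinearMap.trace ℝ (TangentSpace 𝓘(ℝ, E) x)
    (((g.val x).inverse ∘L ricci g x :
      TangentSpace 𝓘(ℝ, E) x →L[ℝ] TangentSpace 𝓘(ℝ, E) x) :
      TangentSpace 𝓘(ℝ, E) x →ₗ[ℝ] TangentSpace 𝓘(ℝ, E) x)

/-- The Einstein tensor `Ric - (R/2) g`. -/
def einstein (g : LorentzMetric E M) (x : M) :
    TangentSpace 𝓘(ℝ, E) x →L[ℝ] TangentSpace 𝓘(ℝ, E) x →L[ℝ] ℝ :=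
  ricci g x - (scalarCurvature g x / 2) • g.val x

end Spacetime

/-! ### Null hypersurfaces -/

section Surface

variable {E : Type*} [NormedAddCommGroup E] [NormedSpace ℝ E]
  {M : Type*} [TopologicalSpace M] [ChartedSpace E M] [IsManifold 𝓘(ℝ, E) ∞ M]
  {F : Type*} [NormedAddCommGroup F] [NormedSpace ℝ F]
  {N : Type*} [TopologicalSpace N] [ChartedSpace F N]

/-- A vector field on `N` regarded as a vector field along `ι : N → M`. -/
def push (ι : N → M) (Y : ∀ p : N, TangentSpace 𝓘(ℝ, F) p) (p : N) :
    TangentSpace 𝓘(ℝ, E) (ι p) :=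
  mfderiv 𝓘(ℝ, F) 𝓘(ℝ, E) ι p (Y p)

/-- The induced (degenerate) metric `q_{ab}`, the pullback of `g` to `N`. -/
def inducedMetric (g : LorentzMetric E M) (ι : N → M) (p : N) :
    TangentSpace 𝓘(ℝ, F) p →L[ℝ] TangentSpace 𝓘(ℝ, F) p →L[ℝ] ℝ :=
  pullForm (g.val (ι p)) (mfderiv 𝓘(ℝ, F) 𝓘(ℝ, E) ι p)

/-- `ι : N → M` is a smooth immersion whose induced metric is degenerate at every point.
(That `N` has codimension one is stated separately.) -/
structure IsNullImmersion (g : LorentzMetric E M) (ι : N → M) : Prop where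
  contMDiff : ContMDiff 𝓘(ℝ, F) 𝓘(ℝ, E) ∞ ι
  injective (p : N) : Function.Injective (mfderiv 𝓘(ℝ, F) 𝓘(ℝ, E) ι p)
  degenerate (p : N) : ∃ v : TangentSpace 𝓘(ℝ, F) p, v ≠ 0 ∧ ∀ w, inducedMetric g ι p v w = 0

/-- `Y` is a smooth vector field on the subset `U` of `N`. -/
def IsSmoothFieldOn (U : Set N) (Y : ∀ p : N, TangentSpace 𝓘(ℝ, F) p)
    [IsManifold 𝓘(ℝ, F) ∞ N] : Prop :=
  ContMDiffOn 𝓘(ℝ, F) 𝓘(ℝ, F).tangent ∞ (fun p ↦ (⟨p, Y p⟩ : TangentBundle 𝓘(ℝ, F) N)) U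

/-- `ℓ` is a smooth null vector field defined on the open subset `U` of `N` and tangent to `N`
(zeros are allowed). -/
structure IsNullFieldOn [IsManifold 𝓘(ℝ, F) ∞ N] (g : LorentzMetric E M) (ι : N → M)
    (U : Set N) (ℓ : ∀ p : N, TangentSpace 𝓘(ℝ, F) p) : Prop where
  isOpen : IsOpen U
  smooth : IsSmoothFieldOn U ℓ
  null : ∀ p ∈ U, inducedMetric g ι p (ℓ p) (ℓ p) = 0

/-- The spacetime Levi-Civita derivative `∇_X V` at `p` of a vector field `V` along `ι : N → M`,
in the direction of a vector `X` tangent to `N`. In the chart of `M` at `ι p` it is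
`X(V^α) + Γ^α_{βγ} X^β V^γ`. For tangent `V` it is `X^β ∇_β` of any extension of `V` to `M`. -/
def covAlong (g : LorentzMetric E M) (ι : N → M) (V : ∀ p : N, TangentSpace 𝓘(ℝ, E) (ι p))
    (p : N) (X : TangentSpace 𝓘(ℝ, F) p) : TangentSpace 𝓘(ℝ, E) (ι p) :=
  -- the components of `V` and of `X` in the chart at `ι p`
  let V' (q : N) : E := mfderiv 𝓘(ℝ, E) 𝓘(ℝ, E) (extChartAt 𝓘(ℝ, E) (ι p)) (ι q) (V q)
  let X' : E := mfderiv 𝓘(ℝ, E) 𝓘(ℝ, E) (extChartAt 𝓘(ℝ, E) (ι p)) (ι p)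
    (mfderiv 𝓘(ℝ, F) 𝓘(ℝ, E) ι p X)
  let DV : E := mfderiv 𝓘(ℝ, F) 𝓘(ℝ, E) V' p X
  (mfderiv 𝓘(ℝ, E) 𝓘(ℝ, E) (extChartAt 𝓘(ℝ, E) (ι p)) (ι p)).inverse
    (DV + christoffel g (ι p) (extChartAt 𝓘(ℝ, E) (ι p) (ι p)) X' (V' p))

/-- The pullback `B_{ab}` to `N` of `∇_β ℓ_α`: `B(X,Y) = g(X, ∇_Y ℓ)`. -/
def derivTensor (g : LorentzMetric E M) (ι : N → M) (ℓ : ∀ p : N, TangentSpace 𝓘(ℝ, F) p)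
    (p : N) (X Y : TangentSpace 𝓘(ℝ, F) p) : ℝ :=
  g.val (ι p) (mfderiv 𝓘(ℝ, F) 𝓘(ℝ, E) ι p X) (covAlong g ι (push ι ℓ) p Y)

/-- `θ` is the expansion at `p` of the null field `ℓ`: the trace of `B_{ab}` with respect to the
positive definite metric that `q_{ab}` induces on the quotient of `T_p N` by the null direction.
The trace is computed in vectors `e_A` of `T_p N`, one fewer than the dimension of `N`, that
represent an orthonormal basis of the quotient; as `B` descends to the quotient, the choice is
immaterial. -/
def HasExpansion (g : LorentzMetric E M) (ι : N → M) (ℓ : ∀ p : N, TangentSpace 𝓘(ℝ, F) p)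
    (p : N) (θ : ℝ) : Prop :=
  ∃ e : Fin (Module.finrank ℝ F - 1) → TangentSpace 𝓘(ℝ, F) p,
    (∀ A B, inducedMetric g ι p (e A) (e B) = if A = B then 1 else 0) ∧
    ∑ A, derivTensor g ι ℓ p (e A) (e A) = θ

/-- The null surface is non-expanding: at every point the expansion of some non-trivial null
field tangent to `N` and defined near the point vanishes. -/
def IsNonExpanding [IsManifold 𝓘(ℝ, F) ∞ N] (g : LorentzMetric E M) (ι : N → M) : Prop :=
  ∀ p : N, ∃ (U : Set N) (ℓ : ∀ p : N, TangentSpace 𝓘(ℝ, F) p),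
    IsNullFieldOn g ι U ℓ ∧ p ∈ U ∧ ℓ p ≠ 0 ∧ HasExpansion g ι ℓ p 0

/-- The Einstein equations with cosmological constant `Λ` and energy-momentum tensor `T` hold at
the points of the surface. -/
def EinsteinOn [FiniteDimensional ℝ E] (g : LorentzMetric E M) (ι : N → M) (Λ : ℝ)
    (T : ∀ x : M, TangentSpace 𝓘(ℝ, E) x →L[ℝ] TangentSpace 𝓘(ℝ, E) x →L[ℝ] ℝ) : Prop :=
  ∀ p : N, einstein g (ι p) = -(Λ • g.val (ι p)) + T (ι p)

/-- The energy condition `T_{αβ} ℓ^α ℓ^β ≥ 0` for null vectors `ℓ` tangent to the surface. -/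
def NullEnergyCondition (g : LorentzMetric E M) (ι : N → M)
    (T : ∀ x : M, TangentSpace 𝓘(ℝ, E) x →L[ℝ] TangentSpace 𝓘(ℝ, E) x →L[ℝ] ℝ) : Prop :=
  ∀ (p : N) (v : TangentSpace 𝓘(ℝ, F) p), inducedMetric g ι p v v = 0 →
    0 ≤ T (ι p) (mfderiv 𝓘(ℝ, F) 𝓘(ℝ, E) ι p v) (mfderiv 𝓘(ℝ, F) 𝓘(ℝ, E) ι p v)

/-- The Stronger Energy Condition: `-T^μ_ν ℓ^ν` is causal and future directed (or zero) for every
future directed null vector `ℓ` tangent to the surface. (At the points of the surface `T` is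
symmetric, by the Einstein equations.) -/
def StrongerEnergyCondition (g : LorentzMetric E M) (τ : TimeOrientation g) (ι : N → M)
    (T : ∀ x : M, TangentSpace 𝓘(ℝ, E) x →L[ℝ] TangentSpace 𝓘(ℝ, E) x →L[ℝ] ℝ) : Prop :=
  ∀ (p : N) (v : TangentSpace 𝓘(ℝ, F) p), inducedMetric g ι p v v = 0 →
    g.val (ι p) (τ.field (ι p)) (mfderiv 𝓘(ℝ, F) 𝓘(ℝ, E) ι p v) < 0 →
    IsFutureCausal τ
      (-(raise g (ι p) (T (ι p) (mfderiv 𝓘(ℝ, F) 𝓘(ℝ, E) ι p v))))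

/-- The induced covariant derivative `D_X Y`: the vector tangent to `N` whose image is `∇_X Y`. -/
def inducedDeriv (g : LorentzMetric E M) (ι : N → M) (Y : ∀ p : N, TangentSpace 𝓘(ℝ, F) p)
    (p : N) (X : TangentSpace 𝓘(ℝ, F) p) : TangentSpace 𝓘(ℝ, F) p :=
  Classical.epsilon fun Z : TangentSpace 𝓘(ℝ, F) p ↦
    mfderiv 𝓘(ℝ, F) 𝓘(ℝ, E) ι p Z = covAlong g ι (push ι Y) p X

/-- The rotation 1-form potential `ω` of `ℓ`: the 1-form with `D_X ℓ = ω(X) ℓ`. -/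
def rotationForm (g : LorentzMetric E M) (ι : N → M) (ℓ : ∀ p : N, TangentSpace 𝓘(ℝ, F) p)
    (p : N) : TangentSpace 𝓘(ℝ, F) p →L[ℝ] ℝ :=
  Classical.epsilon fun α : TangentSpace 𝓘(ℝ, F) p →L[ℝ] ℝ ↦
    ∀ X, inducedDeriv g ι ℓ p X = α X • ℓ p

/-- The surface gravity `κ = ω(ℓ)`. -/
def surfaceGravity (g : LorentzMetric E M) (ι : N → M) (ℓ : ∀ p : N, TangentSpace 𝓘(ℝ, F) p)
    (p : N) : ℝ :=
  rotationForm g ι ℓ p (ℓ p)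

end Surface

/-! ### Lie derivative and exterior derivative on `N` -/

section Forms

variable {F : Type*} [NormedAddCommGroup F] [NormedSpace ℝ F]
  {N : Type*} [TopologicalSpace N] [ChartedSpace F N]

/-- A vector field in the chart at `c`. -/
def chartField (X : ∀ p : N, TangentSpace 𝓘(ℝ, F) p) (c : N) (y : F) : F :=
  mfderiv 𝓘(ℝ, F) 𝓘(ℝ, F) (extChartAt 𝓘(ℝ, F) c) ((extChartAt 𝓘(ℝ, F) c).symm y)
    (X ((extChartAt 𝓘(ℝ, F) c).symm y))

/-- A 1-form in the chart at `c`. -/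
def chartOneForm (α : ∀ p : N, TangentSpace 𝓘(ℝ, F) p →L[ℝ] ℝ) (c : N) (y : F) : F →L[ℝ] ℝ :=
  (α ((extChartAt 𝓘(ℝ, F) c).symm y)) ∘L
    (mfderiv 𝓘(ℝ, F) 𝓘(ℝ, F) (extChartAt 𝓘(ℝ, F) c).symm y)

/-- A `(0,2)` tensor field in the chart at `c`. -/
def chartTwoTensor
    (β : ∀ p : N, TangentSpace 𝓘(ℝ, F) p →L[ℝ] TangentSpace 𝓘(ℝ, F) p →L[ℝ] ℝ)
    (c : N) (y : F) : F →L[ℝ] F →L[ℝ] ℝ :=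
  pullForm (β ((extChartAt 𝓘(ℝ, F) c).symm y))
    (mfderiv 𝓘(ℝ, F) 𝓘(ℝ, F) (extChartAt 𝓘(ℝ, F) c).symm y)

/-- The Lie derivative of a 1-form: `(L_ℓ α)_a = ℓ^b ∂_b α_a + α_b ∂_a ℓ^b`. -/
def lieOneForm (ℓ : ∀ p : N, TangentSpace 𝓘(ℝ, F) p)
    (α : ∀ p : N, TangentSpace 𝓘(ℝ, F) p →L[ℝ] ℝ) (p : N) (X : TangentSpace 𝓘(ℝ, F) p) : ℝ :=
  let y : F := extChartAt 𝓘(ℝ, F) p p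
  let X' : F := mfderiv 𝓘(ℝ, F) 𝓘(ℝ, F) (extChartAt 𝓘(ℝ, F) p) p X
  fderiv ℝ (chartOneForm α p) y (chartField ℓ p y) X'
    + chartOneForm α p y (fderiv ℝ (chartField ℓ p) y X')

/-- The Lie derivative of a `(0,2)` tensor:
`(L_ℓ β)_{ab} = ℓ^c ∂_c β_{ab} + β_{cb} ∂_a ℓ^c + β_{ac} ∂_b ℓ^c`. -/
def lieTwoTensor (ℓ : ∀ p : N, TangentSpace 𝓘(ℝ, F) p)
    (β : ∀ p : N, TangentSpace 𝓘(ℝ, F) p →L[ℝ] TangentSpace 𝓘(ℝ, F) p →L[ℝ] ℝ)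
    (p : N) (X Y : TangentSpace 𝓘(ℝ, F) p) : ℝ :=
  let y : F := extChartAt 𝓘(ℝ, F) p p
  let X' : F := mfderiv 𝓘(ℝ, F) 𝓘(ℝ, F) (extChartAt 𝓘(ℝ, F) p) p X
  let Y' : F := mfderiv 𝓘(ℝ, F) 𝓘(ℝ, F) (extChartAt 𝓘(ℝ, F) p) p Y
  fderiv ℝ (chartTwoTensor β p) y (chartField ℓ p y) X' Y'
    + chartTwoTensor β p y (fderiv ℝ (chartField ℓ p) y X') Y'
    + chartTwoTensor β p y X' (fderiv ℝ (chartField ℓ p) y Y')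

/-- The exterior derivative of a 1-form: `(dα)_{ab} = ∂_a α_b - ∂_b α_a`. -/
def extDerivOneForm (α : ∀ p : N, TangentSpace 𝓘(ℝ, F) p →L[ℝ] ℝ) (p : N)
    (X Y : TangentSpace 𝓘(ℝ, F) p) : ℝ :=
  let y : F := extChartAt 𝓘(ℝ, F) p p
  let X' : F := mfderiv 𝓘(ℝ, F) 𝓘(ℝ, F) (extChartAt 𝓘(ℝ, F) p) p X
  let Y' : F := mfderiv 𝓘(ℝ, F) 𝓘(ℝ, F) (extChartAt 𝓘(ℝ, F) p) p Y
  fderiv ℝ (chartOneForm α p) y X' Y' - fderiv ℝ (chartOneForm α p) y Y' X'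

/-- `α` is a smooth 1-form on the subset `U` of `N`. -/
def IsSmoothOneFormOn [IsManifold 𝓘(ℝ, F) ∞ N] (U : Set N)
    (α : ∀ p : N, TangentSpace 𝓘(ℝ, F) p →L[ℝ] ℝ) : Prop :=
  ContMDiffOn 𝓘(ℝ, F) (𝓘(ℝ, F).prod 𝓘(ℝ, F →L[ℝ] ℝ)) ∞
    (fun p ↦ Bundle.TotalSpace.mk' (F →L[ℝ] ℝ)
      (E := fun p : N ↦ TangentSpace 𝓘(ℝ, F) p →L[ℝ] ℝ) p (α p)) U

/-- `β` is a smooth `(0,2)` tensor field on `N`. -/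
def IsSmoothTwoTensor [IsManifold 𝓘(ℝ, F) ∞ N]
    (β : ∀ p : N, TangentSpace 𝓘(ℝ, F) p →L[ℝ] TangentSpace 𝓘(ℝ, F) p →L[ℝ] ℝ) : Prop :=
  ContMDiff 𝓘(ℝ, F) (𝓘(ℝ, F).prod 𝓘(ℝ, F →L[ℝ] F →L[ℝ] ℝ)) ∞
    (fun p ↦ Bundle.TotalSpace.mk' (F →L[ℝ] F →L[ℝ] ℝ)
      (E := fun p : N ↦ TangentSpace 𝓘(ℝ, F) p →L[ℝ] TangentSpace 𝓘(ℝ, F) p →L[ℝ] ℝ) p (β p))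

end Forms

end NullSurface

end

/-
Let `ℓ` be a null field. As `N` is null, `ℓ` is geodesic and twist-free, and
`B(X, Y) = g(∇_X ℓ, Y)` is a symmetric form on `TN/L`. It is trace-free because `N` is
non-expanding, so Raychaudhuri's equation gives `|B|² = -Ric(ℓ, ℓ) = -T(ℓ, ℓ) ≤ 0` and `B = 0`.
Hence the second fundamental form of `N` is orthogonal to `ℓ`, that is, tangent to `N`: the
submanifold is totally geodesic, `∇` induces a derivative `D`, and `D ℓ = ω ⊗ ℓ`.

Differentiating once more, `R(X, Y) ℓ = dω(X, Y) ℓ`. The left-hand side is tensorial in `ℓ`, so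
`dω` does not depend on the null field. Taking the trace gives `Ric(ℓ, X) = dω(ℓ, X)`, which by
Einstein's equations is `T(ℓ, X)`. The vector `-T(ℓ)♯` is causal and orthogonal to `ℓ`, as
`T(ℓ, ℓ) = dω(ℓ, ℓ) = 0`, so it is a multiple of `ℓ` and `T(ℓ, X) = 0` for tangent `X`. Thus
`ℓ ⌟ dω = 0`, and Cartan's formula yields both `L_ℓ ω = d(ω(ℓ))` and `L_ℓ dω = 0`.
-/

noncomputable section

namespace NullSurface

section LinearAlgebra

variable {E : Type*} [NormedAddCommGroup E] [NormedSpace ℝ E]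
  {F : Type*} [NormedAddCommGroup F] [NormedSpace ℝ F]

theorem trace_eq_trace_of_comp_eq {K V W : Type*} [Field K] [AddCommGroup V] [Module K V]
    [FiniteDimensional K V] [AddCommGroup W] [Module K W] [FiniteDimensional K W]
    {A : W →ₗ[K] V} (hA : Function.Injective A) {T : V →ₗ[K] V} {S : W →ₗ[K] W}
    (hT : LinearMap.range T ≤ LinearMap.range A) (hTS : T ∘ₗ A = A ∘ₗ S) :
    LinearMap.trace K V T = LinearMap.trace K W S := by
  obtain ⟨P, hP⟩ := A.exists_leftInverse_of_injective (LinearMap.ker_eq_bot.2 hA)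
  have hT_factor : T = A ∘ₗ P ∘ₗ T := by
    ext u
    obtain ⟨Z, hZ⟩ := hT (LinearMap.mem_range_self T u)
    simp [← hZ, ← LinearMap.comp_apply P A, hP]
  rw [hT_factor, LinearMap.trace_comp_comm', LinearMap.comp_assoc, hTS, ← LinearMap.comp_assoc,
    hP, LinearMap.id_comp]

theorem trace_eq_zero_of_skew [FiniteDimensional ℝ E] {b : E →L[ℝ] E →L[ℝ] ℝ}
    (hb : b.IsInvertible) {T : E →ₗ[ℝ] E} (hT : ∀ v w, b (T v) w = -b v (T w)) :
    LinearMap.trace ℝ E T = 0 := by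
  obtain ⟨e, rfl⟩ := hb
  let e' : E ≃ₗ[ℝ] Module.Dual ℝ E :=
    e.toLinearEquiv.trans LinearMap.toContinuousLinearMap.symm
  have hconj : e'.conj T = -Module.Dual.transpose (R := ℝ) T := by
    ext φ w
    obtain ⟨v, rfl⟩ := e'.surjective φ
    rw [LinearEquiv.conj_apply_apply, e'.symm_apply_apply]
    exact hT v w
  have htrace := LinearMap.trace_conj' T e'
  rw [hconj, map_neg, LinearMap.trace_transpose'] at htrace
  linarith

/-- Symmetric bilinear forms of signature `(-,+,…,+)`, in the encoding of `LorentzMetric`. -/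
structure IsLorentz (b : E →L[ℝ] E →L[ℝ] ℝ) : Prop where
  symm (v w : E) : b v w = b w v
  signature : ∃ v : E, b v v < 0 ∧ ∀ w : E, b v w = 0 → w ≠ 0 → 0 < b w w

namespace IsLorentz

variable {b : E →L[ℝ] E →L[ℝ] ℝ}

theorem eq_zero (hb : IsLorentz b) {v : E} (hv : ∀ w, b v w = 0) : v = 0 := by
  obtain ⟨t, -, ht⟩ := hb.signature
  by_contra hne
  exact (ht v (by rw [hb.symm, hv]) hne).ne' (hv v)

theorem isInvertible [FiniteDimensional ℝ E] (hb : IsLorentz b) : b.IsInvertible := by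
  have hinj : Function.Injective (b : E →ₗ[ℝ] E →L[ℝ] ℝ) :=
    (injective_iff_map_eq_zero _).2 fun v hv ↦ hb.eq_zero (DFunLike.congr_fun hv)
  have hfinrank : Module.finrank ℝ E = Module.finrank ℝ (E →L[ℝ] ℝ) := by
    rw [← (LinearMap.toContinuousLinearMap (𝕜 := ℝ) (E := E) (F' := ℝ)).finrank_eq]
    exact (Subspace.dual_finrank_eq (K := ℝ) (V := E)).symm
  exact ⟨(LinearEquiv.ofInjectiveOfFinrankEq _ hinj hfinrank).toContinuousLinearEquiv, rfl⟩

theorem pullForm (hb : IsLorentz b) (A : F ≃L[ℝ] E) :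
    IsLorentz (pullForm b (A : F →L[ℝ] E)) where
  symm v w := hb.symm _ _
  signature := by
    obtain ⟨t, htt, ht⟩ := hb.signature
    refine ⟨A.symm t, by simpa [pullForm_apply] using htt, fun w hw hne ↦ ht (A w) ?_ ?_⟩
    · simpa [pullForm_apply] using hw
    · simpa using hne

theorem exists_eq_smul_of_null (hb : IsLorentz b) {a c : E} (ha : a ≠ 0) (haa : b a a = 0)
    (hcc : b c c ≤ 0) (hac : b a c = 0) : ∃ r : ℝ, c = r • a := by
  obtain ⟨t, -, ht⟩ := hb.signature
  have hta : b t a ≠ 0 := fun h ↦ (ht a h ha).ne' haa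
  -- `r` is chosen to make `c - r • a` orthogonal to the timelike `t`, where `b` is positive
  refine ⟨b t c / b t a, by_contra fun h ↦ ?_⟩
  have hpos := ht (c - (b t c / b t a) • a) (by simp [hta]) (sub_ne_zero.2 h)
  simp only [map_sub, map_smul, sub_apply, smul_apply, smul_eq_mul, haa, hac,
    hb.symm c a] at hpos
  linarith

theorem nonneg_of_orthogonal_null (hb : IsLorentz b) {a c : E} (ha : a ≠ 0) (haa : b a a = 0)
    (hac : b a c = 0) : 0 ≤ b c c := by
  by_contra! hcc
  obtain ⟨r, rfl⟩ := hb.exists_eq_smul_of_null ha haa hcc.le hac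
  simp [haa] at hcc

theorem ne_zero_of_timelike_of_null (hb : IsLorentz b) {a c : E} (ha : a ≠ 0)
    (haa : b a a = 0) (hcc : b c c < 0) : b c a ≠ 0 := fun h ↦
  (hb.nonneg_of_orthogonal_null ha haa (by rw [hb.symm, h])).not_gt hcc

theorem range_eq_ker [FiniteDimensional ℝ E] (hb : IsLorentz b)
    {A : F →L[ℝ] E} (hA : Function.Injective A)
    (hdim : Module.finrank ℝ E = Module.finrank ℝ F + 1) {k : E} (hk : k ≠ 0)
    (hkA : ∀ X, b k (A X) = 0) :
    LinearMap.range (A : F →ₗ[ℝ] E) = LinearMap.ker (b k : E →ₗ[ℝ] ℝ) := by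
  have hle : LinearMap.range (A : F →ₗ[ℝ] E) ≤ LinearMap.ker (b k : E →ₗ[ℝ] ℝ) := by
    rintro _ ⟨X, rfl⟩
    exact hkA X
  have hrange : Module.finrank ℝ (LinearMap.range (A : F →ₗ[ℝ] E)) = Module.finrank ℝ F :=
    LinearMap.finrank_range_of_inj hA
  have hker : LinearMap.ker (b k : E →ₗ[ℝ] ℝ) ≠ ⊤ := fun h ↦ hk <| hb.eq_zero fun w ↦
    LinearMap.mem_ker.1 (h ▸ Submodule.mem_top : w ∈ LinearMap.ker (b k : E →ₗ[ℝ] ℝ))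
  have hlt := Submodule.finrank_lt hker
  exact Submodule.eq_of_le_of_finrank_le hle (by lia)

end IsLorentz

/-- A null vector `ℓ` of a degenerate form `q` together with vectors `e` that represent an
orthonormal basis of the quotient by `ℓ`, as in `HasExpansion`. -/
structure IsScreenFrame {ι : Type*} [Fintype ι] [DecidableEq ι] (q : F →L[ℝ] F →L[ℝ] ℝ) (ℓ : F)
    (e : ι → F) : Prop where
  symm (X Y : F) : q X Y = q Y X
  null (X : F) : q ℓ X = 0
  ne_zero : ℓ ≠ 0
  orthonormal (A B : ι) : q (e A) (e B) = if A = B then 1 else 0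
  card_add_one : Fintype.card ι + 1 = Module.finrank ℝ F

namespace IsScreenFrame

variable {ι : Type*} [Fintype ι] [DecidableEq ι] {q : F →L[ℝ] F →L[ℝ] ℝ} {ℓ : F} {e : ι → F}

theorem form_sum (h : IsScreenFrame q ℓ e) (c : Option ι → ℝ) (A : ι) :
    q (∑ i, c i • i.elim ℓ e) (e A) = c (some A) := by
  simp [Fintype.sum_option, h.null, h.orthonormal]

theorem linearIndependent (h : IsScreenFrame q ℓ e) :
    LinearIndependent ℝ (fun i : Option ι ↦ i.elim ℓ e) := by
  refine Fintype.linearIndependent_iff.2 fun c hc ↦ ?_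
  have hsome (A : ι) : c (some A) = 0 := by
    rw [← h.form_sum c A, hc, map_zero, zero_apply]
  rintro (_ | A)
  · simpa [Fintype.sum_option, hsome, h.ne_zero] using hc
  · exact hsome A

/-- The basis of the degenerate space consisting of the null vector and the frame. -/
def basis (h : IsScreenFrame q ℓ e) : Module.Basis (Option ι) ℝ F :=
  basisOfLinearIndependentOfCardEqFinrank h.linearIndependent
    (by rw [Fintype.card_option, h.card_add_one])

theorem basis_apply (h : IsScreenFrame q ℓ e) (i : Option ι) : h.basis i = i.elim ℓ e := by
  simp [basis]

theorem repr_some (h : IsScreenFrame q ℓ e) (X : F) (A : ι) :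
    h.basis.repr X (some A) = q X (e A) := by
  conv_rhs => rw [← h.basis.sum_repr X]
  simp only [h.basis_apply, h.form_sum]

theorem form_eq_sum (h : IsScreenFrame q ℓ e) (X Y : F) :
    q X Y = ∑ A, q X (e A) * q (e A) Y := by
  conv_lhs => rw [← h.basis.sum_repr X]
  simp [Fintype.sum_option, h.basis_apply, h.repr_some, h.null]

theorem trace_eq (h : IsScreenFrame q ℓ e) (S : F →L[ℝ] F) {κ : ℝ} (hS : S ℓ = κ • ℓ) :
    LinearMap.trace ℝ F S = κ + ∑ A, q (S (e A)) (e A) := by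
  have hnone : h.basis.repr (S ℓ) none = κ := by
    have hℓ : h.basis.repr ℓ = Finsupp.single none 1 := by
      rw [← h.basis.repr_self, h.basis_apply, Option.elim_none]
    simp [hS, hℓ]
  rw [LinearMap.trace_eq_matrix_trace ℝ h.basis, Matrix.trace, Fintype.sum_option]
  simp [LinearMap.toMatrix_apply, h.basis_apply, h.repr_some, hnone]

variable {S : F →L[ℝ] F} {κ : ℝ}

theorem trace_comp_self_eq (h : IsScreenFrame q ℓ e) (hS : ∀ X Y, q (S X) Y = q X (S Y))
    (hκ : S ℓ = κ • ℓ) :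
    LinearMap.trace ℝ F (S ∘L S : F →L[ℝ] F) = κ ^ 2 + ∑ A, ∑ B, q (S (e A)) (e B) ^ 2 := by
  rw [h.trace_eq (S ∘L S) (κ := κ ^ 2) (by simp [hκ, smul_smul, sq])]
  refine congrArg (κ ^ 2 + ·) (Finset.sum_congr rfl fun A _ ↦ ?_)
  rw [ContinuousLinearMap.comp_apply, hS, h.form_eq_sum]
  exact Finset.sum_congr rfl fun B _ ↦ by rw [h.symm (e B), sq]

theorem form_eq_zero_of_trace_comp_self_le (h : IsScreenFrame q ℓ e)
    (hS : ∀ X Y, q (S X) Y = q X (S Y)) (hκ : S ℓ = κ • ℓ)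
    (htrace : LinearMap.trace ℝ F (S ∘L S : F →L[ℝ] F) ≤ κ ^ 2) (X Y : F) : q (S X) Y = 0 := by
  rw [h.trace_comp_self_eq hS hκ] at htrace
  have hsum : ∑ A, ∑ B, q (S (e A)) (e B) ^ 2 = 0 :=
    le_antisymm (by linarith) (by positivity)
  have hframe (A B : ι) : q (S (e A)) (e B) = 0 := by
    have hrow := (Finset.sum_eq_zero_iff_of_nonneg fun A _ ↦ by positivity).1 hsum A
      (Finset.mem_univ A)
    exact pow_eq_zero_iff two_ne_zero |>.1 <|
      (Finset.sum_eq_zero_iff_of_nonneg fun B _ ↦ by positivity).1 hrow B (Finset.mem_univ B)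
  have hleft (B : ι) : q (S X) (e B) = 0 := by
    rw [hS, h.form_eq_sum]
    exact Finset.sum_eq_zero fun A _ ↦ by rw [← hS, hframe, mul_zero]
  rw [h.form_eq_sum]
  exact Finset.sum_eq_zero fun B _ ↦ by rw [hleft, zero_mul]

end IsScreenFrame

end LinearAlgebra

section Calculus

variable {E : Type*} [NormedAddCommGroup E] [NormedSpace ℝ E]
  {F : Type*} [NormedAddCommGroup F] [NormedSpace ℝ F]
  {H : Type*} [NormedAddCommGroup H] [NormedSpace ℝ H]

theorem hasFDerivAt_of_contDiffAt {f : F → E} {y : F} (hf : ContDiffAt ℝ ∞ f y) :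
    HasFDerivAt f (fderiv ℝ f y) y :=
  (hf.differentiableAt (by simp)).hasFDerivAt

theorem contDiffAt_fderiv {f : F → E} {y : F} (hf : ContDiffAt ℝ ∞ f y) :
    ContDiffAt ℝ ∞ (fderiv ℝ f) y :=
  hf.fderiv_right (m := ∞) (by simp)

theorem fderiv_fderiv_comm {f : F → E} {y : F} (hf : ContDiffAt ℝ ∞ f y) (X Y : F) :
    fderiv ℝ (fderiv ℝ f) y X Y = fderiv ℝ (fderiv ℝ f) y Y X := by
  have hsmooth : minSmoothness ℝ 2 ≤ (∞ : WithTop ℕ∞) := by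
    rw [minSmoothness_of_isRCLikeNormedField]
    exact ENat.LEInfty.out
  exact hf.isSymmSndFDerivAt hsmooth X Y

theorem fderiv_apply_comm {T : F → E →L[ℝ] E →L[ℝ] H} {y : F} (hT : DifferentiableAt ℝ T y)
    (hsymm : ∀ᶠ z in 𝓝 y, ∀ v w, T z v w = T z w v) (X : F) (v w : E) :
    fderiv ℝ T y X v w = fderiv ℝ T y X w v := by
  let flip := (ContinuousLinearMap.flipₗᵢ ℝ E E H).toContinuousLinearEquiv
  have hflip : T =ᶠ[𝓝 y] fun z ↦ flip (T z) := by
    filter_upwards [hsymm] with z hz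
    ext v w
    exact hz v w
  have hderiv : fderiv ℝ (fun z ↦ flip (T z)) y X = flip (fderiv ℝ T y X) :=
    DFunLike.congr_fun (flip.hasFDerivAt.comp y hT.hasFDerivAt).fderiv X
  exact DFunLike.congr_fun (DFunLike.congr_fun
    ((DFunLike.congr_fun hflip.fderiv_eq X).trans hderiv) v) w

end Calculus

section LocalMetric

variable {E : Type*} [NormedAddCommGroup E] [NormedSpace ℝ E]

/-- Christoffel symbols of the first kind of a metric on a normed space; for `chartMetric` they
are `christoffelLower`. -/
def leviCivitaLower (G : E → E →L[ℝ] E →L[ℝ] ℝ) (y : E) : E →L[ℝ] E →L[ℝ] E →L[ℝ] ℝ :=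
  (2⁻¹ : ℝ) • (fderiv ℝ G y + (fderiv ℝ G y).flip - flipLast (fderiv ℝ G y).flip)

theorem leviCivitaLower_apply (G : E → E →L[ℝ] E →L[ℝ] ℝ) (y u v w : E) :
    leviCivitaLower G y u v w =
      2⁻¹ * (fderiv ℝ G y u v w + fderiv ℝ G y v u w - fderiv ℝ G y w u v) :=
  rfl

/-- Christoffel symbols of the second kind of a metric on a normed space; for `chartMetric` they
are `christoffel`. -/
def leviCivita (G : E → E →L[ℝ] E →L[ℝ] ℝ) (y : E) : E →L[ℝ] E →L[ℝ] E :=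
  ContinuousLinearMap.compL ℝ E (E →L[ℝ] ℝ) E (G y).inverse ∘L leviCivitaLower G y

theorem leviCivita_apply (G : E → E →L[ℝ] E →L[ℝ] ℝ) (y u v : E) :
    leviCivita G y u v = (G y).inverse (leviCivitaLower G y u v) :=
  rfl

/-- The part `∂_u Γ(v, w) + Γ(u, Γ(v, w))` of the Riemann tensor before skew-symmetrization;
for `chartMetric` it is `chartRiemannAux`. -/
def riemannAux (G : E → E →L[ℝ] E →L[ℝ] ℝ) (y : E) : E →L[ℝ] E →L[ℝ] E →L[ℝ] E :=
  fderiv ℝ (leviCivita G) y +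
    (ContinuousLinearMap.compL ℝ E E E).bilinearComp (leviCivita G y) (leviCivita G y)

/-- The Riemann tensor `(u, v, w) ↦ R(u, v) w` of a metric on a normed space; for `chartMetric`
it is `chartRiemann`. -/
def riemann (G : E → E →L[ℝ] E →L[ℝ] ℝ) (y : E) : E →L[ℝ] E →L[ℝ] E →L[ℝ] E :=
  riemannAux G y - (riemannAux G y).flip

theorem riemann_apply (G : E → E →L[ℝ] E →L[ℝ] ℝ) (y u v w : E) :
    riemann G y u v w =
      (fderiv ℝ (leviCivita G) y u v w + leviCivita G y u (leviCivita G y v w))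
      - (fderiv ℝ (leviCivita G) y v u w + leviCivita G y v (leviCivita G y u w)) :=
  rfl

/-- The Ricci tensor of a metric on a normed space, the trace of `u ↦ R(u, v) w`. -/
def ricciAt (G : E → E →L[ℝ] E →L[ℝ] ℝ) (y v w : E) : ℝ :=
  LinearMap.trace ℝ E (((riemann G y).flip v).flip w : E →L[ℝ] E)

/-- `G` is a smooth pseudo-Riemannian metric on the open subset `V` of a normed space. -/
structure IsMetricOn (G : E → E →L[ℝ] E →L[ℝ] ℝ) (V : Set E) : Prop where
  isOpen : IsOpen V
  contDiffOn : ContDiffOn ℝ ∞ G V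
  symm : ∀ y ∈ V, ∀ v w, G y v w = G y w v
  isInvertible : ∀ y ∈ V, (G y).IsInvertible

namespace IsMetricOn

variable {G : E → E →L[ℝ] E →L[ℝ] ℝ} {V : Set E}

theorem contDiffAt (hG : IsMetricOn G V) {y : E} (hy : y ∈ V) : ContDiffAt ℝ ∞ G y :=
  hG.contDiffOn.contDiffAt (hG.isOpen.mem_nhds hy)

theorem hasFDerivAt (hG : IsMetricOn G V) {y : E} (hy : y ∈ V) :
    HasFDerivAt G (fderiv ℝ G y) y :=
  hasFDerivAt_of_contDiffAt (hG.contDiffAt hy)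

theorem fderiv_symm (hG : IsMetricOn G V) {y : E} (hy : y ∈ V) (u v w : E) :
    fderiv ℝ G y u v w = fderiv ℝ G y u w v := by
  refine fderiv_apply_comm (hG.hasFDerivAt hy).differentiableAt ?_ u v w
  filter_upwards [hG.isOpen.mem_nhds hy] with z hz using hG.symm z hz

theorem leviCivita_symm (hG : IsMetricOn G V) {y : E} (hy : y ∈ V) (u v : E) :
    leviCivita G y u v = leviCivita G y v u := by
  have hlower : leviCivitaLower G y u v = leviCivitaLower G y v u := by
    ext w
    rw [leviCivitaLower_apply, leviCivitaLower_apply, hG.fderiv_symm hy w u v]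
    ring
  rw [leviCivita_apply, leviCivita_apply, hlower]

theorem metric_leviCivita (hG : IsMetricOn G V) {y : E} (hy : y ∈ V) (u v w : E) :
    G y (leviCivita G y u v) w = leviCivitaLower G y u v w := by
  rw [leviCivita_apply, (hG.isInvertible y hy).self_apply_inverse]

theorem fderiv_metric (hG : IsMetricOn G V) {y : E} (hy : y ∈ V) (u v w : E) :
    fderiv ℝ G y u v w = G y (leviCivita G y u v) w + G y v (leviCivita G y u w) := by
  rw [hG.metric_leviCivita hy, hG.symm y hy v, hG.metric_leviCivita hy,
    leviCivitaLower_apply, leviCivitaLower_apply, hG.fderiv_symm hy u w v]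
  ring

theorem leviCivita_unique (hG : IsMetricOn G V) {y : E} (hy : y ∈ V) {C : E → E → E}
    (hC : ∀ u v, C u v = C v u)
    (hm : ∀ u v w, fderiv ℝ G y u v w = G y (C u v) w + G y v (C u w)) (u v : E) :
    C u v = leviCivita G y u v := by
  refine (hG.isInvertible y hy).injective ?_
  ext w
  rw [hG.metric_leviCivita hy, leviCivitaLower_apply, hm u v w, hm v u w, hm w u v, hC v u,
    hC w u, hC w v, hG.symm y hy u (C v w), hG.symm y hy v (C u w)]
  ring

variable [FiniteDimensional ℝ E]

theorem contDiffAt_leviCivita (hG : IsMetricOn G V) {y : E} (hy : y ∈ V) :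
    ContDiffAt ℝ ∞ (leviCivita G) y := by
  have hD : ContDiffAt ℝ ∞ (fderiv ℝ G) y := contDiffAt_fderiv (hG.contDiffAt hy)
  have hflip : ContDiffAt ℝ ∞ (fun y ↦ (fderiv ℝ G y).flip) y :=
    (ContinuousLinearMap.flipₗᵢ ℝ E E (E →L[ℝ] ℝ)).contDiff.contDiffAt.comp y hD
  have hflipLast : ContDiffAt ℝ ∞ (fun y ↦ flipLast (fderiv ℝ G y).flip) y :=
    contDiffAt_const.clm_comp hflip
  have hlower : ContDiffAt ℝ ∞ (leviCivitaLower G) y :=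
    ((hD.add hflip).sub hflipLast).const_smul _
  have hinv : ContDiffAt ℝ ∞ (fun y ↦ (G y).inverse) y := by
    obtain ⟨e, he⟩ := hG.isInvertible y hy
    have : ContDiffAt ℝ ∞ ContinuousLinearMap.inverse (G y) := he ▸ contDiffAt_map_inverse e
    exact this.comp y (hG.contDiffAt hy)
  exact ((ContinuousLinearMap.compL ℝ E (E →L[ℝ] ℝ) E).contDiff.contDiffAt.comp y hinv).clm_comp
    hlower

theorem hasFDerivAt_leviCivita (hG : IsMetricOn G V) {y : E} (hy : y ∈ V) :
    HasFDerivAt (leviCivita G) (fderiv ℝ (leviCivita G) y) y :=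
  hasFDerivAt_of_contDiffAt (hG.contDiffAt_leviCivita hy)

theorem fderiv_leviCivita_symm (hG : IsMetricOn G V) {y : E} (hy : y ∈ V) (u v w : E) :
    fderiv ℝ (leviCivita G) y u v w = fderiv ℝ (leviCivita G) y u w v := by
  refine fderiv_apply_comm (hG.hasFDerivAt_leviCivita hy).differentiableAt ?_ u v w
  filter_upwards [hG.isOpen.mem_nhds hy] with z hz using hG.leviCivita_symm hz

theorem riemann_bianchi (hG : IsMetricOn G V) {y : E} (hy : y ∈ V) (u v w : E) :
    riemann G y u v w - riemann G y u w v = -riemann G y v w u := by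
  simp only [riemann_apply]
  rw [hG.fderiv_leviCivita_symm hy u v w, hG.fderiv_leviCivita_symm hy v u w,
    hG.fderiv_leviCivita_symm hy w v u, hG.leviCivita_symm hy v w, hG.leviCivita_symm hy u w,
    hG.leviCivita_symm hy v u]
  abel

end IsMetricOn

end LocalMetric

section DerivativeAlongMap

variable {E : Type*} [NormedAddCommGroup E] [NormedSpace ℝ E]
  {F : Type*} [NormedAddCommGroup F] [NormedSpace ℝ F]

/-- The push-forward `f_* Y` of a vector field `Y`, a vector field along `f`. -/
def pushField (f : F → E) (Y : F → F) (y : F) : E :=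
  fderiv ℝ f y (Y y)

/-- The covariant derivative `∇_X U` at `y` of a vector field `U` along `f`, linear in `X`. -/
def covD (G : E → E →L[ℝ] E →L[ℝ] ℝ) (f U : F → E) (y : F) : F →L[ℝ] E :=
  fderiv ℝ U y + (leviCivita G (f y)).flip (U y) ∘L fderiv ℝ f y

theorem covD_apply (G : E → E →L[ℝ] E →L[ℝ] ℝ) (f U : F → E) (y X : F) :
    covD G f U y X = fderiv ℝ U y X + leviCivita G (f y) (fderiv ℝ f y X) (U y) :=
  rfl

theorem covD_congr {G : E → E →L[ℝ] E →L[ℝ] ℝ} {f f' U U' : F → E} {y : F}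
    (hf : f =ᶠ[𝓝 y] f') (hU : U =ᶠ[𝓝 y] U') : covD G f U y = covD G f' U' y := by
  rw [covD, covD, hf.fderiv_eq, hU.fderiv_eq, hf.eq_of_nhds, hU.eq_of_nhds]

/-- The second fundamental form of `f`, that is `∇_X f_* Y` for a constant field `Y`. It takes
values in all of `E`, since a null hypersurface has no normal complement. -/
def secondForm (G : E → E →L[ℝ] E →L[ℝ] ℝ) (f : F → E) (y : F) : F →L[ℝ] F →L[ℝ] E :=
  fderiv ℝ (fderiv ℝ f) y +
    ContinuousLinearMap.precomp E (fderiv ℝ f y) ∘L leviCivita G (f y) ∘L fderiv ℝ f y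

theorem secondForm_apply (G : E → E →L[ℝ] E →L[ℝ] ℝ) (f : F → E) (y X Y : F) :
    secondForm G f y X Y = fderiv ℝ (fderiv ℝ f) y X Y +
      leviCivita G (f y) (fderiv ℝ f y X) (fderiv ℝ f y Y) :=
  rfl

/-- `f` maps the open set `W` smoothly into the domain `V` of the pseudo-Riemannian
metric `G`. -/
structure IsMapInto (G : E → E →L[ℝ] E →L[ℝ] ℝ) (V : Set E) (f : F → E) (W : Set F) :
    Prop where
  metric : IsMetricOn G V
  isOpen : IsOpen W
  mapsTo : Set.MapsTo f W V
  contDiffOn : ContDiffOn ℝ ∞ f W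

theorem IsMetricOn.isMapInto_id {G : E → E →L[ℝ] E →L[ℝ] ℝ} {V : Set E} (hG : IsMetricOn G V) :
    IsMapInto G V id V :=
  ⟨hG, hG.isOpen, Set.mapsTo_id V, contDiffOn_id⟩

namespace IsMapInto

variable {G : E → E →L[ℝ] E →L[ℝ] ℝ} {V : Set E} {f : F → E} {W : Set F} {y : F}

theorem contDiffAt (hf : IsMapInto G V f W) (hy : y ∈ W) : ContDiffAt ℝ ∞ f y :=
  hf.contDiffOn.contDiffAt (hf.isOpen.mem_nhds hy)

theorem hasFDerivAt (hf : IsMapInto G V f W) (hy : y ∈ W) : HasFDerivAt f (fderiv ℝ f y) y :=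
  hasFDerivAt_of_contDiffAt (hf.contDiffAt hy)

theorem hasFDerivAt_fderiv (hf : IsMapInto G V f W) (hy : y ∈ W) :
    HasFDerivAt (fderiv ℝ f) (fderiv ℝ (fderiv ℝ f) y) y :=
  hasFDerivAt_of_contDiffAt (contDiffAt_fderiv (hf.contDiffAt hy))

theorem contDiffAt_pushField (hf : IsMapInto G V f W) (hy : y ∈ W) {Y : F → F}
    (hY : ContDiffAt ℝ ∞ Y y) : ContDiffAt ℝ ∞ (pushField f Y) y :=
  (contDiffAt_fderiv (hf.contDiffAt hy)).clm_apply hY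

theorem secondForm_symm (hf : IsMapInto G V f W) (hy : y ∈ W) (X Y : F) :
    secondForm G f y X Y = secondForm G f y Y X := by
  rw [secondForm_apply, secondForm_apply, hf.metric.leviCivita_symm (hf.mapsTo hy),
    fderiv_fderiv_comm (hf.contDiffAt hy)]

theorem covD_pushField (hf : IsMapInto G V f W) (hy : y ∈ W) {Y : F → F}
    (hY : DifferentiableAt ℝ Y y) (X : F) :
    covD G f (pushField f Y) y X =
      fderiv ℝ f y (fderiv ℝ Y y X) + secondForm G f y X (Y y) := by
  have hderiv : fderiv ℝ (pushField f Y) y X =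
      fderiv ℝ f y (fderiv ℝ Y y X) + fderiv ℝ (fderiv ℝ f) y X (Y y) :=
    DFunLike.congr_fun ((hf.hasFDerivAt_fderiv hy).clm_apply hY.hasFDerivAt).fderiv X
  rw [covD_apply, secondForm_apply, hderiv, add_assoc]
  rfl

theorem fderiv_metric (hf : IsMapInto G V f W) (hy : y ∈ W) {U U' : F → E}
    (hU : DifferentiableAt ℝ U y) (hU' : DifferentiableAt ℝ U' y) (X : F) :
    fderiv ℝ (fun z ↦ G (f z) (U z) (U' z)) y X =
      G (f y) (covD G f U y X) (U' y) + G (f y) (U y) (covD G f U' y X) := by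
  have hderiv : fderiv ℝ (fun z ↦ G (f z) (U z) (U' z)) y = _ :=
    ((((hf.metric.hasFDerivAt (hf.mapsTo hy)).comp y (hf.hasFDerivAt hy)).clm_apply
      hU.hasFDerivAt).clm_apply hU'.hasFDerivAt).fderiv
  rw [hderiv, covD_apply, covD_apply]
  simp [hf.metric.fderiv_metric (hf.mapsTo hy)]
  ring

theorem contDiffAt_metric (hf : IsMapInto G V f W) (hy : y ∈ W) {U U' : F → E}
    (hU : ContDiffAt ℝ ∞ U y) (hU' : ContDiffAt ℝ ∞ U' y) :
    ContDiffAt ℝ ∞ (fun z ↦ G (f z) (U z) (U' z)) y :=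
  (((hf.metric.contDiffAt (hf.mapsTo hy)).comp y (hf.contDiffAt hy)).clm_apply hU).clm_apply hU'

variable [FiniteDimensional ℝ E]

theorem contDiffAt_covD (hf : IsMapInto G V f W) (hy : y ∈ W) {U : F → E}
    (hU : ContDiffAt ℝ ∞ U y) : ContDiffAt ℝ ∞ (covD G f U) y := by
  have hΓ : ContDiffAt ℝ ∞ (fun z ↦ (leviCivita G (f z)).flip) y :=
    (ContinuousLinearMap.flipₗᵢ ℝ E E E).contDiff.contDiffAt.comp y <|
      (hf.metric.contDiffAt_leviCivita (hf.mapsTo hy)).comp y (hf.contDiffAt hy)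
  exact (contDiffAt_fderiv hU).add
    ((hΓ.clm_apply hU).clm_comp (contDiffAt_fderiv (hf.contDiffAt hy)))

theorem fderiv_covD_apply (hf : IsMapInto G V f W) (hy : y ∈ W) {U : F → E}
    (hU : ContDiffAt ℝ ∞ U y) (X Y : F) :
    fderiv ℝ (fun z ↦ covD G f U z Y) y X =
      fderiv ℝ (fderiv ℝ U) y X Y
      + (fderiv ℝ (leviCivita G) (f y) (fderiv ℝ f y X) (fderiv ℝ f y Y) (U y)
      + leviCivita G (f y) (fderiv ℝ (fderiv ℝ f) y X Y) (U y)
      + leviCivita G (f y) (fderiv ℝ f y Y) (fderiv ℝ U y X)) := by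
  have hDU := (hasFDerivAt_of_contDiffAt (contDiffAt_fderiv hU)).clm_apply (hasFDerivAt_const Y y)
  have hΓ := (((hf.metric.hasFDerivAt_leviCivita (hf.mapsTo hy)).comp y
    (hf.hasFDerivAt hy)).clm_apply ((hf.hasFDerivAt_fderiv hy).clm_apply
    (hasFDerivAt_const Y y))).clm_apply (hasFDerivAt_of_contDiffAt hU)
  have hderiv : fderiv ℝ (fun z ↦ covD G f U z Y) y = _ := (hDU.add hΓ).fderiv
  rw [hderiv]
  simp
  abel

theorem covD_covD_sub (hf : IsMapInto G V f W) (hy : y ∈ W) {U : F → E}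
    (hU : ContDiffAt ℝ ∞ U y) (X Y : F) :
    covD G f (fun z ↦ covD G f U z Y) y X - covD G f (fun z ↦ covD G f U z X) y Y =
      riemann G (f y) (fderiv ℝ f y X) (fderiv ℝ f y Y) (U y) := by
  rw [covD_apply G f (fun z ↦ covD G f U z Y), covD_apply G f (fun z ↦ covD G f U z X),
    hf.fderiv_covD_apply hy hU, hf.fderiv_covD_apply hy hU, riemann_apply,
    fderiv_fderiv_comm (hf.contDiffAt hy) X Y, fderiv_fderiv_comm hU X Y]
  simp only [covD_apply, map_add]
  abel

theorem fderiv_fderiv_metric (hf : IsMapInto G V f W) (hy : y ∈ W) {U U' : F → E}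
    (hU : ContDiffAt ℝ ∞ U y) (hU' : ContDiffAt ℝ ∞ U' y) (X Y : F) :
    fderiv ℝ (fderiv ℝ (fun z ↦ G (f z) (U z) (U' z))) y X Y =
      G (f y) (covD G f (fun z ↦ covD G f U z Y) y X) (U' y)
      + G (f y) (covD G f U y Y) (covD G f U' y X)
      + (G (f y) (covD G f U y X) (covD G f U' y Y)
      + G (f y) (U y) (covD G f (fun z ↦ covD G f U' z Y) y X)) := by
  have hcovD {A : F → E} (hA : ContDiffAt ℝ ∞ A y) :
      ContDiffAt ℝ ∞ (fun z ↦ covD G f A z Y) y :=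
    (hf.contDiffAt_covD hy hA).clm_apply contDiffAt_const
  have hdiff {A : F → E} (hA : ContDiffAt ℝ ∞ A y) : ∀ᶠ z in 𝓝 y, DifferentiableAt ℝ A z :=
    ((hA.of_le (m := 1) (by simp)).eventually (by simp)).mono
      fun z hz ↦ hz.differentiableAt one_ne_zero
  have hfirst : (fun z ↦ fderiv ℝ (fun z ↦ G (f z) (U z) (U' z)) z Y) =ᶠ[𝓝 y] fun z ↦
      G (f z) (covD G f U z Y) (U' z) + G (f z) (U z) (covD G f U' z Y) := by
    filter_upwards [hf.isOpen.mem_nhds hy, hdiff hU, hdiff hU'] with z hz hUz hUz'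
    exact hf.fderiv_metric hz hUz hUz' Y
  have hsecond : fderiv ℝ (fderiv ℝ (fun z ↦ G (f z) (U z) (U' z))) y X Y =
      fderiv ℝ (fun z ↦ fderiv ℝ (fun z ↦ G (f z) (U z) (U' z)) z Y) y X := by
    rw [((hasFDerivAt_of_contDiffAt (contDiffAt_fderiv
      (hf.contDiffAt_metric hy hU hU'))).clm_apply (hasFDerivAt_const Y y)).fderiv]
    simp
  rw [hsecond, hfirst.fderiv_eq,
    fderiv_fun_add ((hf.contDiffAt_metric hy (hcovD hU) hU').differentiableAt (by simp))
      ((hf.contDiffAt_metric hy hU (hcovD hU')).differentiableAt (by simp)), add_apply,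
    hf.fderiv_metric hy ((hcovD hU).differentiableAt (by simp)) (hU'.differentiableAt (by simp)),
    hf.fderiv_metric hy (hU.differentiableAt (by simp)) ((hcovD hU').differentiableAt (by simp))]

theorem metric_riemann_push (hf : IsMapInto G V f W) (hy : y ∈ W) (X Y : F) (v w : E) :
    G (f y) (riemann G (f y) (fderiv ℝ f y X) (fderiv ℝ f y Y) v) w =
      -G (f y) v (riemann G (f y) (fderiv ℝ f y X) (fderiv ℝ f y Y) w) := by
  have hv : ContDiffAt ℝ ∞ (fun _ : F ↦ v) y := contDiffAt_const
  have hw : ContDiffAt ℝ ∞ (fun _ : F ↦ w) y := contDiffAt_const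
  have hcomm := fderiv_fderiv_comm (hf.contDiffAt_metric hy hv hw) X Y
  rw [hf.fderiv_fderiv_metric hy hv hw, hf.fderiv_fderiv_metric hy hv hw] at hcomm
  rw [← hf.covD_covD_sub hy hv, ← hf.covD_covD_sub hy hw, map_sub, map_sub, sub_apply]
  linarith

end IsMapInto

namespace IsMetricOn

variable {G : E → E →L[ℝ] E →L[ℝ] ℝ} {V : Set E} [FiniteDimensional ℝ E]

theorem metric_riemann (hG : IsMetricOn G V) {y : E} (hy : y ∈ V) (t u v w : E) :
    G y (riemann G y t u v) w = -G y v (riemann G y t u w) := by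
  simpa using hG.isMapInto_id.metric_riemann_push hy t u v w

theorem ricciAt_symm (hG : IsMetricOn G V) {y : E} (hy : y ∈ V) (v w : E) :
    ricciAt G y v w = ricciAt G y w v := by
  have hbianchi : ((((riemann G y).flip v).flip w : E →L[ℝ] E) : E →ₗ[ℝ] E) -
      (((riemann G y).flip w).flip v : E →L[ℝ] E) = -((riemann G y v w : E →L[ℝ] E) :) := by
    ext u
    exact hG.riemann_bianchi hy u v w
  rw [ricciAt, ricciAt, ← sub_eq_zero, ← map_sub, hbianchi, map_neg, neg_eq_zero]
  exact trace_eq_zero_of_skew (hG.isInvertible y hy) fun a b ↦ hG.metric_riemann hy v w a b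

end IsMetricOn

namespace IsMapInto

variable {G G' : E → E →L[ℝ] E →L[ℝ] ℝ} {V V' W : Set E} {χ : E → E}

theorem secondForm_eq_of_isometry [FiniteDimensional ℝ E] (hχ : IsMapInto G' V' χ W)
    (hG : IsMetricOn G V) {y : E} (hyV : y ∈ V) (hyW : y ∈ W)
    (hiso : ∀ᶠ z in 𝓝 y, ∀ v w, G z v w = G' (χ z) (fderiv ℝ χ z v) (fderiv ℝ χ z w)) (u v : E) :
    secondForm G' χ y u v = fderiv ℝ χ y (leviCivita G y u v) := by
  have hinj : Function.Injective (fderiv ℝ χ y) := (injective_iff_map_eq_zero _).2 fun v hv ↦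
    (hG.isInvertible y hyV).injective <| ContinuousLinearMap.ext fun w ↦ by
      rw [hiso.self_of_nhds, hv]
      simp
  have hsurj : Function.Surjective (fderiv ℝ χ y) :=
    LinearMap.surjective_of_injective (f := (fderiv ℝ χ y : E →ₗ[ℝ] E)) hinj
  choose C hC using fun u v ↦ hsurj (secondForm G' χ y u v)
  rw [← hC, hG.leviCivita_unique hyV (C := C)
    (fun u v ↦ hinj (by rw [hC, hC, hχ.secondForm_symm hyW])) fun u v w ↦ ?_]
  have hconst (v : E) : covD G' χ (pushField χ fun _ ↦ v) y u = secondForm G' χ y u v := by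
    simpa using hχ.covD_pushField hyW (differentiableAt_const v) u
  have hpush (v : E) : DifferentiableAt ℝ (pushField χ fun _ ↦ v) y :=
    (hχ.contDiffAt_pushField hyW contDiffAt_const).differentiableAt (by simp)
  have hGχ : (fun z ↦ G z v w) =ᶠ[𝓝 y] fun z ↦
      G' (χ z) (pushField χ (fun _ ↦ v) z) (pushField χ (fun _ ↦ w) z) := by
    filter_upwards [hiso] with z hz using hz v w
  have hderiv : fderiv ℝ (fun z ↦ G z v w) y u = fderiv ℝ G y u v w := by
    rw [(((hG.hasFDerivAt hyV).clm_apply (hasFDerivAt_const v y)).clm_apply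
      (hasFDerivAt_const w y)).fderiv]
    simp
  rw [← hderiv, hGχ.fderiv_eq, hχ.fderiv_metric hyW (hpush v) (hpush w), hconst, hconst,
    hiso.self_of_nhds, hiso.self_of_nhds, hC, hC]
  rfl

theorem covD_comp (hχ : IsMapInto G' V' χ W) {f U : F → E} {y : F} (hy : f y ∈ W)
    (hΓ : ∀ u v, secondForm G' χ (f y) u v = fderiv ℝ χ (f y) (leviCivita G (f y) u v))
    (hf : DifferentiableAt ℝ f y) (hU : DifferentiableAt ℝ U y) (X : F) :
    covD G' (χ ∘ f) (fun z ↦ fderiv ℝ χ (f z) (U z)) y X = fderiv ℝ χ (f y) (covD G f U y X) := by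
  have hfield : fderiv ℝ (fun z ↦ fderiv ℝ χ (f z) (U z)) y = _ :=
    (((hχ.hasFDerivAt_fderiv hy).comp y hf.hasFDerivAt).clm_apply hU.hasFDerivAt).fderiv
  rw [covD_apply, covD_apply, map_add, ← hΓ, secondForm_apply, hfield,
    ((hχ.hasFDerivAt hy).comp y hf.hasFDerivAt).fderiv]
  simp [add_assoc]

end IsMapInto

end DerivativeAlongMap

section Curl

variable {F : Type*} [NormedAddCommGroup F] [NormedSpace ℝ F]

/-- The exterior derivative `(X, Y) ↦ ∂_X α(Y) - ∂_Y α(X)` of a 1-form on a normed space, as a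
bilinear map like the 2-tensors of the statement. -/
def curl (α : F → F →L[ℝ] ℝ) (y : F) : F →L[ℝ] F →L[ℝ] ℝ :=
  fderiv ℝ α y - (fderiv ℝ α y).flip

variable {α : F → F →L[ℝ] ℝ} {y : F}

theorem curl_apply (α : F → F →L[ℝ] ℝ) (y X Y : F) :
    curl α y X Y = fderiv ℝ α y X Y - fderiv ℝ α y Y X :=
  rfl

theorem curl_antisymm (α : F → F →L[ℝ] ℝ) (y X Y : F) : curl α y X Y = -curl α y Y X := by
  rw [curl_apply, curl_apply, neg_sub]

theorem curl_self (α : F → F →L[ℝ] ℝ) (y X : F) : curl α y X X = 0 :=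
  sub_self _

theorem hasFDerivAt_flip_fderiv (hα : ContDiffAt ℝ ∞ α y) :
    HasFDerivAt (fun z ↦ (fderiv ℝ α z).flip)
      ((ContinuousLinearMap.flipₗᵢ ℝ F F ℝ).toContinuousLinearEquiv ∘L
        fderiv ℝ (fderiv ℝ α) y) y :=
  (ContinuousLinearMap.flipₗᵢ ℝ F F ℝ).toContinuousLinearEquiv.hasFDerivAt.comp y
    (hasFDerivAt_of_contDiffAt (contDiffAt_fderiv hα))

theorem contDiffAt_curl (hα : ContDiffAt ℝ ∞ α y) : ContDiffAt ℝ ∞ (curl α) y :=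
  (contDiffAt_fderiv hα).sub
    ((ContinuousLinearMap.flipₗᵢ ℝ F F ℝ).toContinuousLinearEquiv.contDiff.contDiffAt.comp y
      (contDiffAt_fderiv hα))

theorem fderiv_curl_apply (hα : ContDiffAt ℝ ∞ α y) (X Y Z : F) :
    fderiv ℝ (curl α) y X Y Z =
      fderiv ℝ (fderiv ℝ α) y X Y Z - fderiv ℝ (fderiv ℝ α) y X Z Y := by
  have hcurl : HasFDerivAt (curl α) _ y :=
    (hasFDerivAt_of_contDiffAt (contDiffAt_fderiv hα)).sub (hasFDerivAt_flip_fderiv hα)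
  rw [hcurl.fderiv]
  rfl

theorem fderiv_curl_cyclic (hα : ContDiffAt ℝ ∞ α y) (X Y Z : F) :
    fderiv ℝ (curl α) y X Y Z + fderiv ℝ (curl α) y Y Z X + fderiv ℝ (curl α) y Z X Y = 0 := by
  have hcomm := fderiv_fderiv_comm hα
  rw [fderiv_curl_apply hα, fderiv_curl_apply hα, fderiv_curl_apply hα, hcomm X Y, hcomm Y Z,
    hcomm Z X]
  ring

theorem lie_curl_eq_zero (hα : ContDiffAt ℝ ∞ α y) {ℓ : F → F} (hℓ : DifferentiableAt ℝ ℓ y)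
    (hzero : ∀ᶠ z in 𝓝 y, ∀ X, curl α z (ℓ z) X = 0) (X Y : F) :
    fderiv ℝ (curl α) y (ℓ y) X Y + curl α y (fderiv ℝ ℓ y X) Y
      + curl α y X (fderiv ℝ ℓ y Y) = 0 := by
  have hderiv (X Y : F) : fderiv ℝ (curl α) y X (ℓ y) Y + curl α y (fderiv ℝ ℓ y X) Y = 0 := by
    have hcontract := ((hasFDerivAt_of_contDiffAt (contDiffAt_curl hα)).clm_apply
      hℓ.hasFDerivAt).clm_apply (hasFDerivAt_const Y y)
    have hconst : (fun z ↦ curl α z (ℓ z) Y) =ᶠ[𝓝 y] fun _ ↦ 0 := by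
      filter_upwards [hzero] with z hz using hz Y
    simpa [add_comm] using DFunLike.congr_fun
      (hcontract.unique ((hasFDerivAt_const (0 : ℝ) y).congr_of_eventuallyEq hconst)) X
  have hantisymm : fderiv ℝ (curl α) y X Y (ℓ y) = -fderiv ℝ (curl α) y X (ℓ y) Y := by
    rw [fderiv_curl_apply hα, fderiv_curl_apply hα, neg_sub]
  rw [curl_antisymm α y X]
  linarith [fderiv_curl_cyclic hα (ℓ y) X Y, hderiv X Y, hderiv Y X]

theorem curl_pullback {χ : F → F} (hα : DifferentiableAt ℝ α (χ y)) (hχ : ContDiffAt ℝ ∞ χ y)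
    (X Y : F) :
    curl (fun z ↦ α (χ z) ∘L fderiv ℝ χ z) y X Y =
      curl α (χ y) (fderiv ℝ χ y X) (fderiv ℝ χ y Y) := by
  have hpullback : HasFDerivAt (fun z ↦ α (χ z) ∘L fderiv ℝ χ z) _ y :=
    (hα.hasFDerivAt.comp y (hasFDerivAt_of_contDiffAt hχ)).clm_comp
      (hasFDerivAt_of_contDiffAt (contDiffAt_fderiv hχ))
  have hderiv (X Y : F) : fderiv ℝ (fun z ↦ α (χ z) ∘L fderiv ℝ χ z) y X Y =
      α (χ y) (fderiv ℝ (fderiv ℝ χ) y X Y)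
        + fderiv ℝ α (χ y) (fderiv ℝ χ y X) (fderiv ℝ χ y Y) := by
    rw [hpullback.fderiv]
    rfl
  rw [curl_apply, curl_apply, hderiv, hderiv, fderiv_fderiv_comm hχ X Y, add_sub_add_left_eq_sub]

end Curl

section NullHypersurface

variable {E : Type*} [NormedAddCommGroup E] [NormedSpace ℝ E]
  {F : Type*} [NormedAddCommGroup F] [NormedSpace ℝ F]

theorem exists_contDiffAt_leftInverse {H : Type*} [NormedAddCommGroup H] [NormedSpace ℝ H]
    [FiniteDimensional ℝ E] [FiniteDimensional ℝ F] {A : H → F →L[ℝ] E} {y : H}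
    (hA : ContDiffAt ℝ ∞ A y) (hinj : Function.Injective (A y)) :
    ∃ P : H → E →L[ℝ] F, ContDiffAt ℝ ∞ P y ∧ ∀ᶠ z in 𝓝 y, ∀ X, P z (A z X) = X := by
  obtain ⟨P₀, hP₀⟩ := (A y : F →ₗ[ℝ] E).exists_leftInverse_of_injective
    (LinearMap.ker_eq_bot.2 hinj)
  let P : E →L[ℝ] F := LinearMap.toContinuousLinearMap P₀
  have hP : P ∘L A y = (ContinuousLinearEquiv.refl ℝ F : F →L[ℝ] F) :=
    ContinuousLinearMap.ext fun X ↦ LinearMap.congr_fun hP₀ X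
  have hPA : ContDiffAt ℝ ∞ (fun z ↦ P ∘L A z) y := contDiffAt_const.clm_comp hA
  have hinverse : ContDiffAt ℝ ∞ ContinuousLinearMap.inverse (P ∘L A y) :=
    hP.symm ▸ contDiffAt_map_inverse (n := ∞) (ContinuousLinearEquiv.refl ℝ F)
  have hinvertible : ∀ᶠ B in 𝓝 (P ∘L A y), B.IsInvertible :=
    hP.symm ▸ ContinuousLinearEquiv.nhds (ContinuousLinearEquiv.refl ℝ F)
  have hinversePA : ContDiffAt ℝ ∞ (fun z ↦ (P ∘L A z).inverse) y :=
    hinverse.comp (f := fun z ↦ P ∘L A z) y hPA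
  refine ⟨fun z ↦ (P ∘L A z).inverse ∘L P, hinversePA.clm_comp contDiffAt_const, ?_⟩
  filter_upwards [hPA.continuousAt.eventually hinvertible] with z hz X
  exact hz.inverse_apply_self X

/-- `S` is a Weingarten map of the vector field `ℓ` near `y`: a tangential representation
`f_* (S X) = ∇_X f_* ℓ` of the derivatives of `ℓ`. -/
structure IsWeingarten (G : E → E →L[ℝ] E →L[ℝ] ℝ) (f : F → E) (ℓ : F → F)
    (S : F → F →L[ℝ] F) (y : F) : Prop where
  differentiableAt : DifferentiableAt ℝ S y
  push : ∀ᶠ z in 𝓝 y, ∀ X, covD G f (pushField f ℓ) z X = fderiv ℝ f z (S z X)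

variable {G : E → E →L[ℝ] E →L[ℝ] ℝ} {V : Set E} {f : F → E} {W : Set F} {y : F}
  {ℓ : F → F} {S : F → F →L[ℝ] F}

namespace IsMapInto

theorem secondForm_weingarten (hf : IsMapInto G V f W) (hy : y ∈ W)
    (hℓ : DifferentiableAt ℝ ℓ y) (hS : IsWeingarten G f ℓ S y) (X : F) :
    secondForm G f y X (ℓ y) = fderiv ℝ f y (S y X - fderiv ℝ ℓ y X) := by
  rw [map_sub, ← hS.push.self_of_nhds, hf.covD_pushField hy hℓ, add_sub_cancel_left]

variable [FiniteDimensional ℝ E]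

theorem riemann_weingarten (hf : IsMapInto G V f W) (hy : y ∈ W) (hℓ : ContDiffAt ℝ ∞ ℓ y)
    (hS : IsWeingarten G f ℓ S y) (X Y : F) :
    riemann G (f y) (fderiv ℝ f y X) (fderiv ℝ f y Y) (fderiv ℝ f y (ℓ y)) =
      fderiv ℝ f y (fderiv ℝ S y X Y - fderiv ℝ S y Y X)
        + secondForm G f y X (S y Y) - secondForm G f y Y (S y X) := by
  have hcovD (X Y : F) : covD G f (fun z ↦ covD G f (pushField f ℓ) z Y) y X =
      fderiv ℝ f y (fderiv ℝ S y X Y) + secondForm G f y X (S y Y) := by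
    have hpush : (fun z ↦ covD G f (pushField f ℓ) z Y) =ᶠ[𝓝 y] pushField f fun z ↦ S z Y := by
      filter_upwards [hS.push] with z hz using hz Y
    have hSY := hS.differentiableAt.hasFDerivAt.clm_apply (hasFDerivAt_const Y y)
    rw [covD_congr .rfl hpush, hf.covD_pushField hy hSY.differentiableAt, hSY.fderiv]
    simp
  have hcomm := hf.covD_covD_sub hy (hf.contDiffAt_pushField hy hℓ) X Y
  rw [pushField] at hcomm
  rw [← hcomm, hcovD, hcovD, map_sub]
  abel

theorem riemann_weingarten_null (hf : IsMapInto G V f W) (hy : y ∈ W)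
    (hℓ : ContDiffAt ℝ ∞ ℓ y) (hS : IsWeingarten G f ℓ S y) {κ : F → ℝ}
    (hκ : DifferentiableAt ℝ κ y) (hSℓ : ∀ᶠ z in 𝓝 y, S z (ℓ z) = κ z • ℓ z) (X : F) :
    riemann G (f y) (fderiv ℝ f y X) (fderiv ℝ f y (ℓ y)) (fderiv ℝ f y (ℓ y)) =
      fderiv ℝ f y (fderiv ℝ κ y X • ℓ y + κ y • S y X - S y (fderiv ℝ ℓ y X)
        - fderiv ℝ S y (ℓ y) X - S y (S y X) + fderiv ℝ ℓ y (S y X)) := by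
  have hℓ' := hasFDerivAt_of_contDiffAt hℓ
  have hderiv : S y (fderiv ℝ ℓ y X) + fderiv ℝ S y X (ℓ y) =
      κ y • fderiv ℝ ℓ y X + fderiv ℝ κ y X • ℓ y := by
    have hfderiv := Filter.EventuallyEq.fderiv_eq (𝕜 := ℝ) hSℓ
    rw [(hS.differentiableAt.hasFDerivAt.clm_apply hℓ').fderiv,
      (hκ.hasFDerivAt.fun_smul hℓ').fderiv] at hfderiv
    exact DFunLike.congr_fun hfderiv X
  have hsecond := hf.secondForm_weingarten hy hℓ'.differentiableAt hS
  rw [hf.riemann_weingarten hy hℓ hS, hSℓ.self_of_nhds, map_smul, hsecond,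
    hf.secondForm_symm hy (ℓ y), hsecond, ← map_smul, ← map_add, ← map_sub,
    eq_sub_of_add_eq' hderiv]
  congr 1
  module

theorem riemann_rotation (hf : IsMapInto G V f W) (hy : y ∈ W) (hℓ : ContDiffAt ℝ ∞ ℓ y)
    {η : F → F →L[ℝ] ℝ} (hηd : DifferentiableAt ℝ η y)
    (hη : ∀ᶠ z in 𝓝 y, ∀ X, covD G f (pushField f ℓ) z X = η z X • pushField f ℓ z) (X Y : F) :
    riemann G (f y) (fderiv ℝ f y X) (fderiv ℝ f y Y) (fderiv ℝ f y (ℓ y)) =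
      curl η y X Y • fderiv ℝ f y (ℓ y) := by
  have hℓ' := hasFDerivAt_of_contDiffAt hℓ
  have hderiv := (ContinuousLinearMap.smulRightL ℝ F F).hasFDerivAt_of_bilinear
    hηd.hasFDerivAt hℓ'
  have hS : IsWeingarten G f ℓ (fun z ↦ ContinuousLinearMap.smulRightL ℝ F F (η z) (ℓ z)) y :=
    ⟨hderiv.differentiableAt, by filter_upwards [hη] with z hz X; simp [hz, pushField]⟩
  have hsecond (X Y : F) : secondForm G f y X (η y Y • ℓ y) =
      fderiv ℝ f y (η y Y • (η y X • ℓ y - fderiv ℝ ℓ y X)) := by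
    rw [map_smul, hf.secondForm_weingarten hy hℓ'.differentiableAt hS, ← map_smul]
    rfl
  have hderivS (X Y : F) :
      fderiv ℝ (fun z ↦ ContinuousLinearMap.smulRightL ℝ F F (η z) (ℓ z)) y X Y =
        η y Y • fderiv ℝ ℓ y X + fderiv ℝ η y X Y • ℓ y := by
    rw [hderiv.fderiv]
    rfl
  rw [hf.riemann_weingarten hy hℓ hS, hderivS, hderivS, curl_apply]
  simp only [ContinuousLinearMap.smulRightL_apply_apply, ContinuousLinearMap.smulRight_apply,
    hsecond, map_smul, map_add, map_sub]
  module

end IsMapInto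

/-- `f` is a smooth immersed hypersurface, defined on the open set `W`, of a Lorentzian domain. -/
structure IsHypersurface (G : E → E →L[ℝ] E →L[ℝ] ℝ) (V : Set E) (f : F → E) (W : Set F) :
    Prop extends IsMapInto G V f W where
  lorentz : ∀ y ∈ W, IsLorentz (G (f y))
  injective : ∀ y ∈ W, Function.Injective (fderiv ℝ f y)
  finrank : Module.finrank ℝ E = Module.finrank ℝ F + 1

/-- `ℓ` is a smooth nowhere vanishing null field of the hypersurface `f`. -/
structure IsNullFieldIn (G : E → E →L[ℝ] E →L[ℝ] ℝ) (f : F → E) (W : Set F) (ℓ : F → F) :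
    Prop where
  contDiffOn : ContDiffOn ℝ ∞ ℓ W
  ne_zero : ∀ y ∈ W, ℓ y ≠ 0
  null : ∀ y ∈ W, ∀ X, G (f y) (fderiv ℝ f y (ℓ y)) (fderiv ℝ f y X) = 0

/-- The expansion of the null field `ℓ` vanishes at `y`. As `g(e, ∇_e ℓ) = -g(ℓ, ∇_e e)`, the
expansion is computed from the second fundamental form, which makes it linear in `ℓ`. -/
def IsNonExpandingAt (G : E → E →L[ℝ] E →L[ℝ] ℝ) (f : F → E) (ℓ : F → F) (y : F) : Prop :=
  ∃ e : Fin (Module.finrank ℝ F - 1) → F,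
    (∀ A B, G (f y) (fderiv ℝ f y (e A)) (fderiv ℝ f y (e B)) = if A = B then 1 else 0) ∧
    ∑ A, G (f y) (fderiv ℝ f y (ℓ y)) (secondForm G f y (e A) (e A)) = 0

namespace IsHypersurface

theorem contDiffAt_field (hf : IsHypersurface G V f W) (hℓ : IsNullFieldIn G f W ℓ)
    (hy : y ∈ W) : ContDiffAt ℝ ∞ ℓ y :=
  hℓ.contDiffOn.contDiffAt (hf.isOpen.mem_nhds hy)

theorem push_ne_zero (hf : IsHypersurface G V f W) (hℓ : IsNullFieldIn G f W ℓ) (hy : y ∈ W) :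
    fderiv ℝ f y (ℓ y) ≠ 0 := fun h ↦
  hℓ.ne_zero y hy (hf.injective y hy (by rw [h, map_zero]))

theorem exists_eq_smul_of_null (hf : IsHypersurface G V f W) (hℓ : IsNullFieldIn G f W ℓ)
    (hy : y ∈ W) {Z : F} (hZ : G (f y) (fderiv ℝ f y Z) (fderiv ℝ f y Z) = 0) :
    ∃ r : ℝ, Z = r • ℓ y := by
  obtain ⟨r, hr⟩ := (hf.lorentz y hy).exists_eq_smul_of_null
    (hf.push_ne_zero hℓ hy) (hℓ.null y hy _) hZ.le (hℓ.null y hy _)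
  exact ⟨r, hf.injective y hy (by rw [hr, map_smul])⟩

theorem metric_covD_push (hf : IsHypersurface G V f W) (hℓ : IsNullFieldIn G f W ℓ)
    (hy : y ∈ W) {Y : F → F} (hY : DifferentiableAt ℝ Y y) (X : F) :
    G (f y) (covD G f (pushField f ℓ) y X) (pushField f Y y) =
      -G (f y) (pushField f ℓ y) (covD G f (pushField f Y) y X) := by
  have hmetric := hf.fderiv_metric hy
    ((hf.contDiffAt_pushField hy (hf.contDiffAt_field hℓ hy)).differentiableAt (by simp))
    ((hf.hasFDerivAt_fderiv hy).clm_apply hY.hasFDerivAt).differentiableAt X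
  have hzero : (fun z ↦ G (f z) (pushField f ℓ z) (fderiv ℝ f z (Y z))) =ᶠ[𝓝 y] fun _ ↦ 0 := by
    filter_upwards [hf.isOpen.mem_nhds hy] with z hz using hℓ.null z hz (Y z)
  rw [hzero.fderiv_eq, fderiv_fun_const, Pi.zero_apply, zero_apply] at hmetric
  exact eq_neg_of_add_eq_zero_left hmetric.symm

theorem metric_covD_push_eq_secondForm (hf : IsHypersurface G V f W)
    (hℓ : IsNullFieldIn G f W ℓ) (hy : y ∈ W) (X Y : F) :
    G (f y) (covD G f (pushField f ℓ) y X) (fderiv ℝ f y Y) =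
      -G (f y) (fderiv ℝ f y (ℓ y)) (secondForm G f y X Y) := by
  have hconst := hf.metric_covD_push hℓ hy (differentiableAt_const Y) X
  rw [hf.covD_pushField hy (differentiableAt_const Y)] at hconst
  simpa [pushField] using hconst

theorem metric_covD_push_self (hf : IsHypersurface G V f W) (hℓ : IsNullFieldIn G f W ℓ)
    (hy : y ∈ W) (X : F) :
    G (f y) (pushField f ℓ y) (covD G f (pushField f ℓ) y X) = 0 := by
  have hself := hf.metric_covD_push hℓ hy
    ((hf.contDiffAt_field hℓ hy).differentiableAt (by simp)) X
  rw [(hf.lorentz y hy).symm] at hself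
  linarith

theorem weingarten_self_adjoint (hf : IsHypersurface G V f W) (hℓ : IsNullFieldIn G f W ℓ)
    (hy : y ∈ W) {A : F →L[ℝ] F}
    (hA : ∀ X, covD G f (pushField f ℓ) y X = fderiv ℝ f y (A X)) (X Y : F) :
    G (f y) (fderiv ℝ f y (A X)) (fderiv ℝ f y Y) =
      G (f y) (fderiv ℝ f y X) (fderiv ℝ f y (A Y)) := by
  rw [(hf.lorentz y hy).symm (fderiv ℝ f y X), ← hA, ← hA,
    hf.metric_covD_push_eq_secondForm hℓ hy, hf.metric_covD_push_eq_secondForm hℓ hy,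
    hf.secondForm_symm hy]

theorem exists_weingarten_null_eq_smul (hf : IsHypersurface G V f W)
    (hℓ : IsNullFieldIn G f W ℓ) (hy : y ∈ W) {A : F →L[ℝ] F}
    (hA : ∀ X, covD G f (pushField f ℓ) y X = fderiv ℝ f y (A X)) :
    ∃ κ : ℝ, A (ℓ y) = κ • ℓ y := by
  refine hf.exists_eq_smul_of_null hℓ hy ?_
  rw [hf.weingarten_self_adjoint hℓ hy hA, ← hA (A (ℓ y))]
  exact hf.metric_covD_push_self hℓ hy _

theorem exists_push_eq_of_orthogonal [FiniteDimensional ℝ E] (hf : IsHypersurface G V f W)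
    (hℓ : IsNullFieldIn G f W ℓ) (hy : y ∈ W) {u : E} (hu : G (f y) (pushField f ℓ y) u = 0) :
    ∃ Z, fderiv ℝ f y Z = u := by
  have hrange := (hf.lorentz y hy).range_eq_ker (hf.injective y hy) hf.finrank
    (hf.push_ne_zero hℓ hy) (hℓ.null y hy)
  exact (SetLike.ext_iff.1 hrange u).2 hu

variable [FiniteDimensional ℝ F]

theorem isScreenFrame (hf : IsHypersurface G V f W) (hℓ : IsNullFieldIn G f W ℓ) (hy : y ∈ W)
    {e : Fin (Module.finrank ℝ F - 1) → F}
    (he : ∀ A B, G (f y) (fderiv ℝ f y (e A)) (fderiv ℝ f y (e B)) = if A = B then 1 else 0) :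
    IsScreenFrame (pullForm (G (f y)) (fderiv ℝ f y)) (ℓ y) e where
  symm _ _ := (hf.lorentz y hy).symm _ _
  null := hℓ.null y hy
  ne_zero := hℓ.ne_zero y hy
  orthonormal := he
  card_add_one := by
    have : Nontrivial F := ⟨ℓ y, 0, hℓ.ne_zero y hy⟩
    rw [Fintype.card_fin, Nat.sub_add_cancel Module.finrank_pos]

theorem weingarten_null_eq_trace_smul (hf : IsHypersurface G V f W)
    (hℓ : IsNullFieldIn G f W ℓ) (hy : y ∈ W) {A : F →L[ℝ] F}
    (hA : ∀ X, covD G f (pushField f ℓ) y X = fderiv ℝ f y (A X))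
    (hθ : IsNonExpandingAt G f ℓ y) :
    A (ℓ y) = LinearMap.trace ℝ F (A : F →ₗ[ℝ] F) • ℓ y := by
  obtain ⟨e, he, hsum⟩ := hθ
  obtain ⟨κ, hκ⟩ := hf.exists_weingarten_null_eq_smul hℓ hy hA
  rw [(hf.isScreenFrame hℓ hy he).trace_eq A hκ, hκ]
  simp only [pullForm_apply, ← hA, hf.metric_covD_push_eq_secondForm hℓ hy,
    Finset.sum_neg_distrib, hsum, neg_zero, add_zero]

variable [FiniteDimensional ℝ E]

theorem exists_isWeingarten (hf : IsHypersurface G V f W) (hℓ : IsNullFieldIn G f W ℓ)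
    (hy : y ∈ W) : ∃ S, IsWeingarten G f ℓ S y := by
  obtain ⟨P, hP, hPf⟩ := exists_contDiffAt_leftInverse (contDiffAt_fderiv (hf.contDiffAt hy))
    (hf.injective y hy)
  have hcovD := hf.contDiffAt_covD hy (hf.contDiffAt_pushField hy (hf.contDiffAt_field hℓ hy))
  refine ⟨fun z ↦ P z ∘L covD G f (pushField f ℓ) z,
    (hP.clm_comp hcovD).differentiableAt (by simp), ?_⟩
  filter_upwards [hPf, hf.isOpen.mem_nhds hy] with z hz hzW X
  obtain ⟨Z, hZ⟩ := hf.exists_push_eq_of_orthogonal hℓ hzW (hf.metric_covD_push_self hℓ hzW X)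
  rw [ContinuousLinearMap.comp_apply, ← hZ, hz]

theorem ricciAt_eq_trace (hf : IsHypersurface G V f W) (hℓ : IsNullFieldIn G f W ℓ) (hy : y ∈ W)
    {Y : F} {Q : F →L[ℝ] F} (hQ : ∀ X, riemann G (f y) (fderiv ℝ f y X) (fderiv ℝ f y Y)
      (fderiv ℝ f y (ℓ y)) = fderiv ℝ f y (Q X)) :
    ricciAt G (f y) (fderiv ℝ f y Y) (fderiv ℝ f y (ℓ y)) =
      LinearMap.trace ℝ F (Q : F →ₗ[ℝ] F) := by
  refine trace_eq_trace_of_comp_eq (A := (fderiv ℝ f y : F →ₗ[ℝ] E)) (hf.injective y hy) ?_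
    (LinearMap.ext hQ)
  rintro _ ⟨u, rfl⟩
  have hskew := hf.metric.metric_riemann (hf.mapsTo hy) u (fderiv ℝ f y Y)
    (fderiv ℝ f y (ℓ y)) (fderiv ℝ f y (ℓ y))
  rw [(hf.lorentz y hy).symm] at hskew
  exact hf.exists_push_eq_of_orthogonal hℓ hy (self_eq_neg.1 hskew)

theorem ricciAt_null_of_nonExpanding (hf : IsHypersurface G V f W)
    (hℓ : IsNullFieldIn G f W ℓ) (hy : y ∈ W) (hS : IsWeingarten G f ℓ S y)
    (hSℓ : ∀ᶠ z in 𝓝 y, S z (ℓ z) = LinearMap.trace ℝ F (S z : F →ₗ[ℝ] F) • ℓ z) :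
    ricciAt G (f y) (fderiv ℝ f y (ℓ y)) (fderiv ℝ f y (ℓ y)) =
      LinearMap.trace ℝ F (S y : F →ₗ[ℝ] F) ^ 2
        - LinearMap.trace ℝ F ((S y ∘L S y : F →L[ℝ] F) : F →ₗ[ℝ] F) := by
  let tr : (F →L[ℝ] F) →L[ℝ] ℝ := LinearMap.toContinuousLinearMap
    (LinearMap.trace ℝ F ∘ₗ ContinuousLinearMap.coeLM ℝ)
  have hκ : HasFDerivAt (fun z ↦ tr (S z)) (tr ∘L fderiv ℝ S y) y :=
    tr.hasFDerivAt.comp y hS.differentiableAt.hasFDerivAt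
  have hric : ricciAt G (f y) (fderiv ℝ f y (ℓ y)) (fderiv ℝ f y (ℓ y)) =
      tr ((tr ∘L fderiv ℝ S y).smulRight (ℓ y) + tr (S y) • S y
        - S y ∘L fderiv ℝ ℓ y - fderiv ℝ S y (ℓ y) - S y ∘L S y + fderiv ℝ ℓ y ∘L S y) := by
    refine hf.ricciAt_eq_trace hℓ hy (Q := (tr ∘L fderiv ℝ S y).smulRight (ℓ y) + tr (S y) • S y
      - S y ∘L fderiv ℝ ℓ y - fderiv ℝ S y (ℓ y) - S y ∘L S y + fderiv ℝ ℓ y ∘L S y) fun X ↦ ?_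
    rw [hf.riemann_weingarten_null hy (hf.contDiffAt_field hℓ hy) hS hκ.differentiableAt hSℓ,
      hκ.fderiv]
    rfl
  have hcomm : tr (S y ∘L fderiv ℝ ℓ y) = tr (fderiv ℝ ℓ y ∘L S y) :=
    LinearMap.trace_mul_comm ℝ (S y : F →ₗ[ℝ] F) (fderiv ℝ ℓ y : F →ₗ[ℝ] F)
  have hrank_one : tr ((tr ∘L fderiv ℝ S y).smulRight (ℓ y)) = tr (fderiv ℝ S y (ℓ y)) :=
    LinearMap.trace_smulRight ((tr ∘L fderiv ℝ S y : F →L[ℝ] ℝ) : F →ₗ[ℝ] ℝ) (ℓ y)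
  change _ = tr (S y) ^ 2 - tr (S y ∘L S y)
  rw [hric]
  simp only [map_add, map_sub, map_smul, hcomm, hrank_one, smul_eq_mul]
  ring

theorem metric_secondForm_eq_zero (hf : IsHypersurface G V f W) (hℓ : IsNullFieldIn G f W ℓ)
    (hy : y ∈ W) (hθ : ∀ᶠ z in 𝓝 y, IsNonExpandingAt G f ℓ z)
    (hR : 0 ≤ ricciAt G (f y) (fderiv ℝ f y (ℓ y)) (fderiv ℝ f y (ℓ y))) (X Y : F) :
    G (f y) (fderiv ℝ f y (ℓ y)) (secondForm G f y X Y) = 0 := by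
  obtain ⟨S, hS⟩ := hf.exists_isWeingarten hℓ hy
  have hSℓ : ∀ᶠ z in 𝓝 y, S z (ℓ z) = LinearMap.trace ℝ F (S z : F →ₗ[ℝ] F) • ℓ z := by
    filter_upwards [hS.push, hθ, hf.isOpen.mem_nhds hy] with z hSz hθz hz
      using hf.weingarten_null_eq_trace_smul hℓ hz hSz hθz
  rw [hf.ricciAt_null_of_nonExpanding hℓ hy hS hSℓ, sub_nonneg] at hR
  obtain ⟨e, he, -⟩ := hθ.self_of_nhds
  have hzero := (hf.isScreenFrame hℓ hy he).form_eq_zero_of_trace_comp_self_le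
    (hf.weingarten_self_adjoint hℓ hy hS.push.self_of_nhds) hSℓ.self_of_nhds hR X Y
  rwa [pullForm_apply, ← hS.push.self_of_nhds, hf.metric_covD_push_eq_secondForm hℓ hy,
    neg_eq_zero] at hzero

theorem ricciAt_rotation (hf : IsHypersurface G V f W) (hℓ : IsNullFieldIn G f W ℓ)
    (hy : y ∈ W) {η : F → F →L[ℝ] ℝ} (hηd : DifferentiableAt ℝ η y)
    (hη : ∀ᶠ z in 𝓝 y, ∀ X, covD G f (pushField f ℓ) z X = η z X • pushField f ℓ z) (Y : F) :
    ricciAt G (f y) (fderiv ℝ f y Y) (fderiv ℝ f y (ℓ y)) = curl η y (ℓ y) Y := by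
  have hQ (X : F) : riemann G (f y) (fderiv ℝ f y X) (fderiv ℝ f y Y) (fderiv ℝ f y (ℓ y)) =
      fderiv ℝ f y (((curl η y).flip Y).smulRight (ℓ y) X) := by
    rw [hf.riemann_rotation hy (hf.contDiffAt_field hℓ hy) hηd hη]
    simp
  rw [hf.ricciAt_eq_trace hℓ hy hQ]
  exact LinearMap.trace_smulRight ((curl η y).flip Y : F →ₗ[ℝ] ℝ) (ℓ y)

end IsHypersurface

end NullHypersurface

section Charts

variable {E : Type*} [NormedAddCommGroup E] [NormedSpace ℝ E]
  {M : Type*} [TopologicalSpace M] [ChartedSpace E M]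
  {F : Type*} [NormedAddCommGroup F] [NormedSpace ℝ F]
  {N : Type*} [TopologicalSpace N] [ChartedSpace F N]

/-- The derivative at `x` of the chart at `c`. Like the other derivatives below it is typed as a
map between model spaces, which unlike tangent spaces carry a norm. -/
def chartD (c x : M) : E →L[ℝ] E := mfderiv 𝓘(ℝ, E) 𝓘(ℝ, E) (extChartAt 𝓘(ℝ, E) c) x

/-- The derivative at `y` of the inverse of the chart at `c`. -/
def chartDsymm (c : M) (y : E) : E →L[ℝ] E :=
  mfderiv 𝓘(ℝ, E) 𝓘(ℝ, E) (extChartAt 𝓘(ℝ, E) c).symm y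

variable (E F) in
/-- The derivative at `q` of a map between manifolds, as a map between the model spaces. -/
def mapD (h : N → M) (q : N) : F →L[ℝ] E := mfderiv 𝓘(ℝ, F) 𝓘(ℝ, E) h q

variable (E) in
/-- The expression of a map `h` in the charts at `p` and at `c`. -/
def chartRep (h : N → M) (p : N) (c : M) (y : F) : E :=
  extChartAt 𝓘(ℝ, E) c (h ((extChartAt 𝓘(ℝ, F) p).symm y))

variable (E) in
/-- The domain of `chartRep E h p c`. -/
def chartDom (h : N → M) (p : N) (c : M) : Set F :=
  (extChartAt 𝓘(ℝ, F) p).target ∩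
    (extChartAt 𝓘(ℝ, F) p).symm ⁻¹' (h ⁻¹' (extChartAt 𝓘(ℝ, E) c).source)

theorem symm_mem_chart_source {c : M} {y : E} (hy : y ∈ (extChartAt 𝓘(ℝ, E) c).target) :
    (extChartAt 𝓘(ℝ, E) c).symm y ∈ (chartAt E c).source := by
  simpa only [extChartAt_source] using (extChartAt 𝓘(ℝ, E) c).map_target hy

theorem map_symm_mem_chart_source {h : N → M} {p : N} {c : M} {y : F}
    (hy : y ∈ chartDom E h p c) : h ((extChartAt 𝓘(ℝ, F) p).symm y) ∈ (chartAt E c).source := by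
  have hc := hy.2
  rwa [Set.mem_preimage, Set.mem_preimage, extChartAt_source] at hc

theorem isOpen_preimage_chart (c : N) {U : Set N} (hU : IsOpen U) :
    IsOpen ((extChartAt 𝓘(ℝ, F) c).target ∩ (extChartAt 𝓘(ℝ, F) c).symm ⁻¹' U) :=
  (continuousOn_extChartAt_symm c).isOpen_inter_preimage (isOpen_extChartAt_target c) hU

theorem isOpen_chartDom {h : N → M} (hh : Continuous h) (p : N) (c : M) :
    IsOpen (chartDom (F := F) E h p c) :=
  isOpen_preimage_chart p ((isOpen_extChartAt_source c).preimage hh)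

theorem mem_chartDom_self (h : N → M) (p : N) :
    extChartAt 𝓘(ℝ, F) p p ∈ chartDom E h p (h p) := by
  refine ⟨mem_extChartAt_target p, ?_⟩
  rw [Set.mem_preimage, extChartAt_to_inv, Set.mem_preimage]
  exact mem_extChartAt_source (h p)

theorem chartRep_self (h : N → M) (p : N) :
    chartRep E h p (h p) (extChartAt 𝓘(ℝ, F) p p) = extChartAt 𝓘(ℝ, E) (h p) (h p) := by
  rw [chartRep, extChartAt_to_inv]

theorem chartRep_eventuallyEq_transition {ι : N → M} (hι : Continuous ι) {p : N} {c : M}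
    (c' : M) {y : F} (hy : y ∈ chartDom E ι p c) :
    chartRep E ι p c' =ᶠ[𝓝 y] chartRep E (id : M → M) c c' ∘ chartRep E ι p c := by
  filter_upwards [(isOpen_chartDom hι p c).mem_nhds hy] with z hz
  rw [Function.comp_apply, chartRep, chartRep, chartRep, (extChartAt 𝓘(ℝ, E) c).left_inv hz.2, id]

theorem chartRep_mem_chartDom_id {ι : N → M} {p : N} {c c' : M} {y : F} (hy : y ∈ chartDom E ι p c)
    (hy' : y ∈ chartDom E ι p c') : chartRep E ι p c y ∈ chartDom E (id : M → M) c c' := by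
  refine ⟨(extChartAt 𝓘(ℝ, E) c).map_source hy.2, ?_⟩
  rw [Set.mem_preimage, chartRep, (extChartAt 𝓘(ℝ, E) c).left_inv hy.2]
  exact hy'.2

theorem chartD_self [IsManifold 𝓘(ℝ, E) ∞ M] (x : M) (v : E) : chartD x x v = v :=
  DFunLike.congr_fun (mfderiv_extChartAt_self (I := 𝓘(ℝ, E)) (x := x)) v

theorem mapD_id (x : M) (v : E) : mapD E E (id : M → M) x v = v :=
  DFunLike.congr_fun (mfderiv_id (I := 𝓘(ℝ, E)) (x := x)) v

section

variable [IsManifold 𝓘(ℝ, E) ∞ M]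

theorem chartD_chartDsymm {c : M} {y : E} (hy : y ∈ (extChartAt 𝓘(ℝ, E) c).target) (v : E) :
    chartD c ((extChartAt 𝓘(ℝ, E) c).symm y) (chartDsymm c y v) = v := by
  have hcomp := mfderiv_extChartAt_comp_mfderivWithin_extChartAt_symm (I := 𝓘(ℝ, E)) hy
  simp only [ModelWithCorners.range_eq_univ, mfderivWithin_univ] at hcomp
  exact DFunLike.congr_fun hcomp v

theorem chartDsymm_chartD {c : M} {y : E} (hy : y ∈ (extChartAt 𝓘(ℝ, E) c).target) (v : E) :
    chartDsymm c y (chartD c ((extChartAt 𝓘(ℝ, E) c).symm y) v) = v := by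
  have hcomp := mfderivWithin_extChartAt_symm_comp_mfderiv_extChartAt (I := 𝓘(ℝ, E)) hy
  simp only [ModelWithCorners.range_eq_univ, mfderivWithin_univ] at hcomp
  exact DFunLike.congr_fun hcomp v

theorem chartDsymm_extChartAt_chartD {c x : M} (hx : x ∈ (chartAt E c).source) (v : E) :
    chartDsymm c (extChartAt 𝓘(ℝ, E) c x) (chartD c x v) = v := by
  have hx' : x ∈ (extChartAt 𝓘(ℝ, E) c).source := by rwa [extChartAt_source]
  simpa only [(extChartAt 𝓘(ℝ, E) c).left_inv hx'] using
    chartDsymm_chartD ((extChartAt 𝓘(ℝ, E) c).map_source hx') v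

theorem chartD_injective {c x : M} (hx : x ∈ (chartAt E c).source) :
    Function.Injective (chartD (E := E) c x) :=
  Function.LeftInverse.injective (chartDsymm_extChartAt_chartD hx)

theorem chartDsymm_self (x : M) (v : E) : chartDsymm x (extChartAt 𝓘(ℝ, E) x x) v = v := by
  simpa only [chartD_self] using chartDsymm_extChartAt_chartD (mem_chart_source E x) v

theorem chartDsymm_chartField (Y : ∀ x : M, TangentSpace 𝓘(ℝ, E) x) {c : M} {y : E}
    (hy : y ∈ (extChartAt 𝓘(ℝ, E) c).target) :
    chartDsymm c y (chartField Y c y) = Y ((extChartAt 𝓘(ℝ, E) c).symm y) :=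
  chartDsymm_chartD hy _

theorem chartField_self (Y : ∀ x : M, TangentSpace 𝓘(ℝ, E) x) (x : M) :
    chartField Y x (extChartAt 𝓘(ℝ, E) x x) = Y x := by
  rw [← chartDsymm_self x (chartField Y x _), chartDsymm_chartField Y (mem_extChartAt_target x),
    extChartAt_to_inv]

theorem hasMFDerivAt_chart {c x : M} (hx : x ∈ (chartAt E c).source) :
    HasMFDerivAt 𝓘(ℝ, E) 𝓘(ℝ, E) (extChartAt 𝓘(ℝ, E) c) x (chartD (E := E) c x) :=
  (mdifferentiableAt_extChartAt hx).hasMFDerivAt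

theorem contMDiffAt_chart_symm {c : M} {y : E} (hy : y ∈ (extChartAt 𝓘(ℝ, E) c).target) :
    ContMDiffAt 𝓘(ℝ, E) 𝓘(ℝ, E) ∞ (extChartAt 𝓘(ℝ, E) c).symm y :=
  (contMDiffOn_extChartAt_symm c).contMDiffAt ((isOpen_extChartAt_target c).mem_nhds hy)

theorem hasMFDerivAt_chart_symm {c : M} {y : E} (hy : y ∈ (extChartAt 𝓘(ℝ, E) c).target) :
    HasMFDerivAt 𝓘(ℝ, E) 𝓘(ℝ, E) (extChartAt 𝓘(ℝ, E) c).symm y (chartDsymm (E := E) c y) :=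
  ((contMDiffAt_chart_symm hy).mdifferentiableAt (by simp)).hasMFDerivAt

theorem trivializationAt_snd {c x : M} (hx : x ∈ (chartAt E c).source)
    (v : TangentSpace 𝓘(ℝ, E) x) :
    (trivializationAt E (TangentSpace 𝓘(ℝ, E)) c ⟨x, v⟩).2 = chartD (E := E) c x v := by
  have htriv := DFunLike.congr_fun
    (TangentBundle.continuousLinearMapAt_trivializationAt (I := 𝓘(ℝ, E)) hx) v
  rwa [Bundle.Trivialization.continuousLinearMapAt_apply,
    Bundle.Trivialization.coe_linearMapAt_of_mem _ (by simpa using hx)] at htriv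

theorem contDiffOn_chartField {U : Set M} (hU : IsOpen U) {Y : ∀ x : M, TangentSpace 𝓘(ℝ, E) x}
    (hY : IsSmoothFieldOn U Y) (c : M) :
    ContDiffOn ℝ ∞ (chartField Y c)
      ((extChartAt 𝓘(ℝ, E) c).target ∩ (extChartAt 𝓘(ℝ, E) c).symm ⁻¹' U) := by
  intro y hy
  refine ContDiffAt.contDiffWithinAt ?_
  have htriv := ((trivializationAt E (TangentSpace 𝓘(ℝ, E)) c).contMDiffAt_section_iff
    (IB := 𝓘(ℝ, E)) (by simpa using symm_mem_chart_source hy.1)).1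
      (hY.contMDiffAt (hU.mem_nhds hy.2))
  refine (contMDiffAt_iff_contDiffAt.1
    (htriv.comp y (contMDiffAt_chart_symm hy.1))).congr_of_eventuallyEq ?_
  filter_upwards [(isOpen_extChartAt_target (I := 𝓘(ℝ, E)) c).mem_nhds hy.1] with z hz
  exact (trivializationAt_snd (symm_mem_chart_source hz) _).symm

/-- The vector field with constant components `v` in the chart at `c`. -/
def constField (c : M) (v : E) (x : M) : TangentSpace 𝓘(ℝ, E) x :=
  chartDsymm (E := E) c (extChartAt 𝓘(ℝ, E) c x) v

theorem contMDiffAt_constField {c x : M} (hx : x ∈ (chartAt E c).source) (v : E) :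
    ContMDiffAt 𝓘(ℝ, E) 𝓘(ℝ, E).tangent ∞
      (fun z ↦ (⟨z, constField c v z⟩ : TangentBundle 𝓘(ℝ, E) M)) x := by
  refine ((trivializationAt E (TangentSpace 𝓘(ℝ, E)) c).contMDiffAt_section_iff (IB := 𝓘(ℝ, E))
    (by simpa using hx)).2 ((contMDiffAt_const (c := v)).congr_of_eventuallyEq ?_)
  filter_upwards [(chartAt E c).open_source.mem_nhds hx] with z hz
  have hz' : z ∈ (extChartAt 𝓘(ℝ, E) c).source := by rwa [extChartAt_source]
  have hinv := chartD_chartDsymm ((extChartAt 𝓘(ℝ, E) c).map_source hz') v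
  rw [(extChartAt 𝓘(ℝ, E) c).left_inv hz'] at hinv
  exact (trivializationAt_snd hz _).trans hinv

variable [IsManifold 𝓘(ℝ, F) ∞ N] {h : N → M} {p : N} {c : M} {y : F}

theorem contDiffAt_chartRep (hh : ContMDiff 𝓘(ℝ, F) 𝓘(ℝ, E) ∞ h) (hy : y ∈ chartDom E h p c) :
    ContDiffAt ℝ ∞ (chartRep E h p c) y :=
  contMDiffAt_iff_contDiffAt.1 (((contMDiffAt_extChartAt' (I := 𝓘(ℝ, E))
    (map_symm_mem_chart_source hy)).comp _ (hh _)).comp y (contMDiffAt_chart_symm hy.1))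

theorem fderiv_chartRep (hh : ContMDiff 𝓘(ℝ, F) 𝓘(ℝ, E) ∞ h) (hy : y ∈ chartDom E h p c) (X : F) :
    fderiv ℝ (chartRep E h p c) y X =
      chartD c (h ((extChartAt 𝓘(ℝ, F) p).symm y))
        (mapD E F h ((extChartAt 𝓘(ℝ, F) p).symm y) (chartDsymm p y X)) := by
  have hcomp : HasFDerivAt (chartRep E h p c)
      (chartD c (h ((extChartAt 𝓘(ℝ, F) p).symm y)) ∘L
        mapD E F h ((extChartAt 𝓘(ℝ, F) p).symm y) ∘L chartDsymm p y) y :=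
    ((hasMFDerivAt_chart (map_symm_mem_chart_source hy)).comp y
      (((hh _).mdifferentiableAt (by simp)).hasMFDerivAt.comp y
        (hasMFDerivAt_chart_symm hy.1))).hasFDerivAt
  exact DFunLike.congr_fun hcomp.fderiv X

theorem fderiv_chartRep_self (hh : ContMDiff 𝓘(ℝ, F) 𝓘(ℝ, E) ∞ h) (p : N) (X : F) :
    fderiv ℝ (chartRep E h p (h p)) (extChartAt 𝓘(ℝ, F) p p) X = mapD E F h p X := by
  rw [fderiv_chartRep hh (mem_chartDom_self h p), chartDsymm_self, extChartAt_to_inv, chartD_self]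

theorem fderiv_chartRep_chartField_self (hh : ContMDiff 𝓘(ℝ, F) 𝓘(ℝ, E) ∞ h)
    (Y : ∀ q : N, TangentSpace 𝓘(ℝ, F) q) (p : N) :
    fderiv ℝ (chartRep E h p (h p)) (extChartAt 𝓘(ℝ, F) p p)
      (chartField Y p (extChartAt 𝓘(ℝ, F) p p)) = mapD E F h p (Y p) := by
  rw [fderiv_chartRep_self hh, chartField_self]

theorem fderiv_chartRep_injective (hh : ContMDiff 𝓘(ℝ, F) 𝓘(ℝ, E) ∞ h)
    (hinj : ∀ q, Function.Injective (mapD E F h q)) (hy : y ∈ chartDom E h p c) :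
    Function.Injective (fderiv ℝ (chartRep E h p c) y) := by
  intro X Y hXY
  rw [fderiv_chartRep hh hy, fderiv_chartRep hh hy] at hXY
  rw [← chartD_chartDsymm hy.1 X, hinj _ (chartD_injective (map_symm_mem_chart_source hy) hXY),
    chartD_chartDsymm hy.1]

theorem fderiv_transition {c c' : M} {y : E} (hy : y ∈ chartDom E (id : M → M) c c') (v : E) :
    fderiv ℝ (chartRep E (id : M → M) c c') y v =
      chartD c' ((extChartAt 𝓘(ℝ, E) c).symm y) (chartDsymm c y v) := by
  rw [fderiv_chartRep contMDiff_id hy, mapD_id, id_eq]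

theorem mapD_eq_fderiv {u : N → E} (hy : y ∈ (extChartAt 𝓘(ℝ, F) p).target)
    (hu : DifferentiableAt ℝ (u ∘ (extChartAt 𝓘(ℝ, F) p).symm) y) (X : F) :
    mapD E F u ((extChartAt 𝓘(ℝ, F) p).symm y) X =
      fderiv ℝ (u ∘ (extChartAt 𝓘(ℝ, F) p).symm) y
        (chartD p ((extChartAt 𝓘(ℝ, F) p).symm y) X) := by
  have hp := symm_mem_chart_source hy
  rw [← (extChartAt 𝓘(ℝ, F) p).right_inv hy] at hu
  have hcomp := HasMFDerivAt.comp _ hu.hasFDerivAt.hasMFDerivAt (hasMFDerivAt_chart hp)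
  rw [(extChartAt 𝓘(ℝ, F) p).right_inv hy] at hcomp
  have hev : u =ᶠ[𝓝 ((extChartAt 𝓘(ℝ, F) p).symm y)]
      (u ∘ (extChartAt 𝓘(ℝ, F) p).symm) ∘ extChartAt 𝓘(ℝ, F) p := by
    filter_upwards [extChartAt_source_mem_nhds' (I := 𝓘(ℝ, F)) (by rwa [extChartAt_source])]
      with q hq
    rw [Function.comp_apply, Function.comp_apply, (extChartAt 𝓘(ℝ, F) p).left_inv hq]
  exact DFunLike.congr_fun (hcomp.congr_of_eventuallyEq hev).mfderiv X

end

section Metric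

variable [IsManifold 𝓘(ℝ, E) ∞ M]

/-- The metric at `x` as a bilinear form on the model space. -/
def LorentzMetric.form (g : LorentzMetric E M) (x : M) : E →L[ℝ] E →L[ℝ] ℝ := g.val x

theorem LorentzMetric.isLorentz (g : LorentzMetric E M) (x : M) : IsLorentz (g.form x) :=
  ⟨g.symm x, g.signature x⟩

theorem chartMetric_apply (g : LorentzMetric E M) (c : M) (y v w : E) :
    chartMetric g c y v w =
      g.form ((extChartAt 𝓘(ℝ, E) c).symm y) (chartDsymm c y v) (chartDsymm c y w) :=
  rfl

theorem chartMetric_chartD (g : LorentzMetric E M) {c x : M} (hx : x ∈ (chartAt E c).source)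
    (v w : E) :
    chartMetric g c (extChartAt 𝓘(ℝ, E) c x) (chartD c x v) (chartD c x w) = g.form x v w := by
  rw [chartMetric_apply, chartDsymm_extChartAt_chartD hx, chartDsymm_extChartAt_chartD hx,
    (extChartAt 𝓘(ℝ, E) c).left_inv (by rwa [extChartAt_source])]

theorem chartMetric_self (g : LorentzMetric E M) (x : M) (v w : E) :
    chartMetric g x (extChartAt 𝓘(ℝ, E) x x) v w = g.form x v w := by
  rw [chartMetric_apply, chartDsymm_self, chartDsymm_self, extChartAt_to_inv]

theorem isLorentz_chartMetric (g : LorentzMetric E M) {c : M} {y : E}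
    (hy : y ∈ (extChartAt 𝓘(ℝ, E) c).target) : IsLorentz (chartMetric g c y) :=
  (g.isLorentz ((extChartAt 𝓘(ℝ, E) c).symm y)).pullForm <|
    ContinuousLinearEquiv.equivOfInverse (chartDsymm c y)
      (chartD c ((extChartAt 𝓘(ℝ, E) c).symm y)) (chartD_chartDsymm hy) (chartDsymm_chartD hy)

variable [FiniteDimensional ℝ E]

theorem contDiffOn_chartMetric (g : LorentzMetric E M) (c : M) :
    ContDiffOn ℝ ∞ (chartMetric g c) (extChartAt 𝓘(ℝ, E) c).target := by
  refine contDiffOn_clm_apply.2 fun v ↦ contDiffOn_clm_apply.2 fun w y hy ↦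
    ContDiffAt.contDiffWithinAt ?_
  have hx := symm_mem_chart_source hy
  have hconst := ContMDiffAt.clm_bundle_apply₂ (F₁ := E) (F₂ := E) (F₃ := ℝ)
    (E₁ := fun x : M ↦ TangentSpace 𝓘(ℝ, E) x) (E₂ := fun x : M ↦ TangentSpace 𝓘(ℝ, E) x)
    (E₃ := Bundle.Trivial M ℝ) (b := fun x : M ↦ x) (g.contMDiff _)
    (contMDiffAt_constField hx v) (contMDiffAt_constField hx w)
  refine (contMDiffAt_iff_contDiffAt.1 (((Bundle.contMDiffAt_section _).1 hconst).comp y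
    (contMDiffAt_chart_symm hy))).congr_of_eventuallyEq ?_
  filter_upwards [(isOpen_extChartAt_target (I := 𝓘(ℝ, E)) c).mem_nhds hy] with z hz
  change _ = g.form _ (chartDsymm c (extChartAt 𝓘(ℝ, E) c ((extChartAt 𝓘(ℝ, E) c).symm z)) v)
    (chartDsymm c (extChartAt 𝓘(ℝ, E) c ((extChartAt 𝓘(ℝ, E) c).symm z)) w)
  rw [(extChartAt 𝓘(ℝ, E) c).right_inv hz, chartMetric_apply]

theorem isMetricOn_chartMetric (g : LorentzMetric E M) (c : M) :
    IsMetricOn (chartMetric g c) (extChartAt 𝓘(ℝ, E) c).target where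
  isOpen := isOpen_extChartAt_target c
  contDiffOn := contDiffOn_chartMetric g c
  symm _ hy := (isLorentz_chartMetric g hy).symm
  isInvertible _ hy := (isLorentz_chartMetric g hy).isInvertible

theorem isMapInto_chartRep [IsManifold 𝓘(ℝ, F) ∞ N] (g : LorentzMetric E M) {h : N → M}
    (hh : ContMDiff 𝓘(ℝ, F) 𝓘(ℝ, E) ∞ h) (p : N) (c : M) :
    IsMapInto (chartMetric g c) (extChartAt 𝓘(ℝ, E) c).target (chartRep (F := F) E h p c)
      (chartDom E h p c) where
  metric := isMetricOn_chartMetric g c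
  isOpen := isOpen_chartDom hh.continuous p c
  mapsTo _ hy := (extChartAt 𝓘(ℝ, E) c).map_source hy.2
  contDiffOn _ hy := (contDiffAt_chartRep hh hy).contDiffWithinAt

end Metric

end Charts

section ChangeOfCharts

variable {E : Type*} [NormedAddCommGroup E] [NormedSpace ℝ E]
  {M : Type*} [TopologicalSpace M] [ChartedSpace E M] [IsManifold 𝓘(ℝ, E) ∞ M]
  {F : Type*} [NormedAddCommGroup F] [NormedSpace ℝ F]
  {N : Type*} [TopologicalSpace N] [ChartedSpace F N]

/-- The components in the chart at `c` of a vector field along `ι`, as a function on the chart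
at `p`. -/
def compAlong (ι : N → M) (p : N) (c : M) (V : ∀ q : N, TangentSpace 𝓘(ℝ, E) (ι q)) (y : F) : E :=
  chartD (E := E) c (ι ((extChartAt 𝓘(ℝ, F) p).symm y)) (V ((extChartAt 𝓘(ℝ, F) p).symm y))

theorem compAlong_eq_transition {ι : N → M} {p : N} {c c' : M} {y : F} (hy : y ∈ chartDom E ι p c)
    (hy' : y ∈ chartDom E ι p c') (V : ∀ q : N, TangentSpace 𝓘(ℝ, E) (ι q)) :
    compAlong ι p c' V y =
      fderiv ℝ (chartRep E (id : M → M) c c') (chartRep E ι p c y) (compAlong ι p c V y) := by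
  rw [fderiv_transition (chartRep_mem_chartDom_id hy hy'), chartRep,
    (extChartAt 𝓘(ℝ, E) c).left_inv hy.2]
  exact congrArg _ (chartDsymm_extChartAt_chartD (map_symm_mem_chart_source hy) _).symm

variable [IsManifold 𝓘(ℝ, F) ∞ N] {ι : N → M}

theorem covAlong_eq_covD (g : LorentzMetric E M) (hι : ContMDiff 𝓘(ℝ, F) 𝓘(ℝ, E) ∞ ι)
    {p q : N} {y : F} (hy : y ∈ (extChartAt 𝓘(ℝ, F) p).target)
    (hq : (extChartAt 𝓘(ℝ, F) p).symm y = q) {V : ∀ q : N, TangentSpace 𝓘(ℝ, E) (ι q)}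
    (hV : DifferentiableAt ℝ (compAlong ι p (ι q) V) y) (X : F) :
    covAlong g ι V q X =
      covD (chartMetric g (ι q)) (chartRep E ι p (ι q)) (compAlong ι p (ι q) V) y
        (chartD p q X) := by
  subst hq
  set q := (extChartAt 𝓘(ℝ, F) p).symm y
  have hyD : y ∈ chartDom E ι p (ι q) := ⟨hy, mem_extChartAt_source (ι q)⟩
  have hinv : (mfderiv 𝓘(ℝ, E) 𝓘(ℝ, E) (extChartAt 𝓘(ℝ, E) (ι q)) (ι q)).inverse =
      ContinuousLinearMap.id ℝ E := by
    rw [mfderiv_extChartAt_self]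
    exact ContinuousLinearMap.inverse_id
  have hdef : covAlong g ι V q X =
      (mfderiv 𝓘(ℝ, E) 𝓘(ℝ, E) (extChartAt 𝓘(ℝ, E) (ι q)) (ι q)).inverse
        (mapD E F (fun r ↦ chartD (E := E) (ι q) (ι r) (V r)) q X +
          leviCivita (chartMetric g (ι q)) (extChartAt 𝓘(ℝ, E) (ι q) (ι q))
            (chartD (ι q) (ι q) (mapD E F ι q X)) (chartD (E := E) (ι q) (ι q) (V q))) := rfl
  rw [hdef, hinv, mapD_eq_fderiv (u := fun r ↦ chartD (E := E) (ι q) (ι r) (V r)) hy hV,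
    covD_apply, fderiv_chartRep hι hyD, chartDsymm_chartD hy]
  rfl

variable [FiniteDimensional ℝ E]

theorem secondForm_transition (g : LorentzMetric E M) {c c' : M} {y : E}
    (hy : y ∈ chartDom E (id : M → M) c c') (u v : E) :
    secondForm (chartMetric g c') (chartRep E (id : M → M) c c') y u v =
      fderiv ℝ (chartRep E (id : M → M) c c') y (leviCivita (chartMetric g c) y u v) := by
  have htrans := isMapInto_chartRep g (contMDiff_id (I := 𝓘(ℝ, E))) c c'
  refine htrans.secondForm_eq_of_isometry (isMetricOn_chartMetric g c) hy.1 hy ?_ u v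
  filter_upwards [htrans.isOpen.mem_nhds hy] with z hz v w
  rw [fderiv_transition hz, fderiv_transition hz, chartMetric_apply]
  exact (chartMetric_chartD g (map_symm_mem_chart_source hz) _ _).symm

theorem chartD_covAlong (g : LorentzMetric E M) (hι : ContMDiff 𝓘(ℝ, F) 𝓘(ℝ, E) ∞ ι)
    {p : N} {c : M} {y : F} (hy : y ∈ chartDom E ι p c)
    {V : ∀ q : N, TangentSpace 𝓘(ℝ, E) (ι q)}
    (hV : DifferentiableAt ℝ (compAlong ι p c V) y) (X : F) :
    chartD (E := E) c (ι ((extChartAt 𝓘(ℝ, F) p).symm y))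
      (covAlong g ι V ((extChartAt 𝓘(ℝ, F) p).symm y) X) =
      covD (chartMetric g c) (chartRep E ι p c) (compAlong ι p c V) y
        (chartD p ((extChartAt 𝓘(ℝ, F) p).symm y) X) := by
  set c' := ι ((extChartAt 𝓘(ℝ, F) p).symm y)
  have hy' : y ∈ chartDom E ι p c' := ⟨hy.1, mem_extChartAt_source c'⟩
  have hχy := chartRep_mem_chartDom_id hy hy'
  have htrans := isMapInto_chartRep g (contMDiff_id (I := 𝓘(ℝ, E))) c c'
  have hrep : DifferentiableAt ℝ (chartRep E ι p c) y :=
    (contDiffAt_chartRep hι hy).differentiableAt (by simp)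
  have hcomp : compAlong ι p c' V =ᶠ[𝓝 y] fun z ↦
      fderiv ℝ (chartRep E (id : M → M) c c') (chartRep E ι p c z) (compAlong ι p c V z) := by
    filter_upwards [(isOpen_chartDom hι.continuous p c).mem_nhds hy,
      (isOpen_chartDom hι.continuous p c').mem_nhds hy'] with z hz hz'
      using compAlong_eq_transition hz hz' V
  have hV' : DifferentiableAt ℝ (compAlong ι p c' V) y :=
    ((((htrans.hasFDerivAt_fderiv hχy).comp y hrep.hasFDerivAt).clm_apply
      hV.hasFDerivAt).differentiableAt).congr_of_eventuallyEq hcomp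
  have hbase : (extChartAt 𝓘(ℝ, E) c).symm (chartRep E ι p c y) = c' :=
    (extChartAt 𝓘(ℝ, E) c).left_inv hy.2
  rw [covAlong_eq_covD g hι hy.1 rfl hV',
    covD_congr (chartRep_eventuallyEq_transition hι.continuous c' hy) hcomp,
    htrans.covD_comp hχy (secondForm_transition g hχy) hrep hV, fderiv_transition hχy, hbase,
    chartD_self, ← hbase]
  exact chartD_chartDsymm hχy.1 _

end ChangeOfCharts

section NullHypersurfaceCharts

variable {E : Type*} [NormedAddCommGroup E] [NormedSpace ℝ E]
  {M : Type*} [TopologicalSpace M] [ChartedSpace E M]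
  {F : Type*} [NormedAddCommGroup F] [NormedSpace ℝ F]
  {N : Type*} [TopologicalSpace N] [ChartedSpace F N]
  {ι : N → M} {U : Set N} {p : N} {c : M} {y : F}

variable (E) in
/-- The part of `chartDom E ι p c` on which a vector field of domain `U` does not vanish. -/
def fieldDom (ι : N → M) (p : N) (c : M) (U : Set N) (Y : ∀ q : N, TangentSpace 𝓘(ℝ, F) q) :
    Set F :=
  {y | y ∈ chartDom E ι p c ∧ (extChartAt 𝓘(ℝ, F) p).symm y ∈ U ∧ chartField Y p y ≠ 0}

theorem ne_zero_of_mem_fieldDom {Y : ∀ q : N, TangentSpace 𝓘(ℝ, F) q}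
    (hy : y ∈ fieldDom E ι p c U Y) : Y ((extChartAt 𝓘(ℝ, F) p).symm y) ≠ 0 := fun h ↦
  hy.2.2 ((congrArg (chartD (E := F) p _) h).trans (map_zero _))

section

variable [IsManifold 𝓘(ℝ, F) ∞ N] {Y : ∀ q : N, TangentSpace 𝓘(ℝ, F) q}

theorem isOpen_fieldDom (hι : Continuous ι) (hU : IsOpen U) (hY : IsSmoothFieldOn U Y) (p : N)
    (c : M) : IsOpen (fieldDom E ι p c U Y) := by
  convert (isOpen_chartDom (E := E) (F := F) hι p c).inter
    ((contDiffOn_chartField hU hY p).continuousOn.isOpen_inter_preimage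
      (isOpen_preimage_chart p hU) (isOpen_ne (x := (0 : F)))) using 1
  ext y
  exact ⟨fun h ↦ ⟨h.1, ⟨h.1.1, h.2.1⟩, h.2.2⟩, fun h ↦ ⟨h.1, h.2.1.2, h.2.2⟩⟩

theorem mem_fieldDom (hy : y ∈ chartDom E ι p c) (hyU : (extChartAt 𝓘(ℝ, F) p).symm y ∈ U)
    (hY : Y ((extChartAt 𝓘(ℝ, F) p).symm y) ≠ 0) : y ∈ fieldDom E ι p c U Y := by
  refine ⟨hy, hyU, fun h ↦ hY ?_⟩
  rw [← chartDsymm_chartField Y hy.1, h, map_zero]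
  rfl

theorem mem_fieldDom_self (ι : N → M) (hp : p ∈ U) (hY : Y p ≠ 0) :
    extChartAt 𝓘(ℝ, F) p p ∈ fieldDom E ι p (ι p) U Y := by
  refine mem_fieldDom (mem_chartDom_self ι p) ?_ ?_ <;> rwa [extChartAt_to_inv]

end

variable [IsManifold 𝓘(ℝ, E) ∞ M]

/-- The induced metric as a bilinear form on the model space. -/
def inducedForm (g : LorentzMetric E M) (ι : N → M) (q : N) : F →L[ℝ] F →L[ℝ] ℝ :=
  inducedMetric g ι q

namespace IsNullImmersion

variable {g : LorentzMetric E M}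

theorem exists_eq_smul_of_null (hι : IsNullImmersion (F := F) g ι) {w : F} (hw0 : w ≠ 0)
    (hw : ∀ u, inducedForm g ι p w u = 0) {v : F} (hv : inducedForm g ι p v v = 0) :
    ∃ r : ℝ, v = r • w := by
  have hinj : Function.Injective (mapD E F ι p) := hι.injective p
  obtain ⟨r, hr⟩ := (g.isLorentz (ι p)).exists_eq_smul_of_null
    ((map_ne_zero_iff _ hinj).2 hw0) (hw w) (c := mapD E F ι p v) hv.le (hw v)
  exact ⟨r, hinj (by rw [hr, map_smul])⟩

theorem inducedForm_eq_zero (hι : IsNullImmersion (F := F) g ι) {v : F}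
    (hv : inducedForm g ι p v v = 0) (w : F) : inducedForm g ι p v w = 0 := by
  obtain ⟨d, hd0, hd⟩ : ∃ d : F, d ≠ 0 ∧ ∀ w, inducedForm g ι p d w = 0 := hι.degenerate p
  obtain ⟨r, rfl⟩ := hι.exists_eq_smul_of_null hd0 hd hv
  rw [map_smul, smul_apply, hd, smul_zero]

end IsNullImmersion

variable [IsManifold 𝓘(ℝ, F) ∞ N]

theorem compAlong_push (hι : ContMDiff 𝓘(ℝ, F) 𝓘(ℝ, E) ∞ ι)
    (Y : ∀ q : N, TangentSpace 𝓘(ℝ, F) q) (hy : y ∈ chartDom E ι p c) :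
    compAlong ι p c (push ι Y) y = pushField (chartRep E ι p c) (chartField Y p) y := by
  rw [pushField, fderiv_chartRep hι hy, chartDsymm_chartField Y hy.1]
  rfl

theorem metric_chartRep (g : LorentzMetric E M) (hι : ContMDiff 𝓘(ℝ, F) 𝓘(ℝ, E) ∞ ι)
    (hy : y ∈ chartDom E ι p c) (X Y : F) :
    chartMetric g c (chartRep E ι p c y) (fderiv ℝ (chartRep E ι p c) y X)
      (fderiv ℝ (chartRep E ι p c) y Y) =
      inducedForm g ι ((extChartAt 𝓘(ℝ, F) p).symm y) (chartDsymm p y X) (chartDsymm p y Y) := by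
  rw [fderiv_chartRep hι hy, fderiv_chartRep hι hy]
  exact chartMetric_chartD g (map_symm_mem_chart_source hy) _ _

theorem isNullFieldIn_chartField {g : LorentzMetric E M} (hι : IsNullImmersion (F := F) g ι)
    {ℓ : ∀ q : N, TangentSpace 𝓘(ℝ, F) q} (hℓ : IsNullFieldOn g ι U ℓ) (p : N) (c : M) :
    IsNullFieldIn (chartMetric g c) (chartRep E ι p c) (fieldDom E ι p c U ℓ)
      (chartField ℓ p) where
  contDiffOn := (contDiffOn_chartField hℓ.isOpen hℓ.smooth p).mono fun _ h ↦ ⟨h.1.1, h.2.1⟩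
  ne_zero _ hy := hy.2.2
  null y hy X := by
    rw [metric_chartRep g hι.contMDiff hy.1, chartDsymm_chartField ℓ hy.1.1]
    exact hι.inducedForm_eq_zero (hℓ.null _ hy.2.1) _

/-- `ι` is an immersed null submanifold of codimension one. -/
structure IsNullHypersurface (g : LorentzMetric E M) (ι : N → M) : Prop
    extends IsNullImmersion (F := F) g ι where
  finrank : Module.finrank ℝ E = Module.finrank ℝ F + 1

variable [FiniteDimensional ℝ E] {g : LorentzMetric E M}

theorem chartD_covAlong_push (g : LorentzMetric E M) (hι : ContMDiff 𝓘(ℝ, F) 𝓘(ℝ, E) ∞ ι)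
    (hy : y ∈ chartDom E ι p c) {Y : ∀ q : N, TangentSpace 𝓘(ℝ, F) q}
    (hY : DifferentiableAt ℝ (chartField Y p) y) (X : F) :
    chartD (E := E) c (ι ((extChartAt 𝓘(ℝ, F) p).symm y))
      (covAlong g ι (push ι Y) ((extChartAt 𝓘(ℝ, F) p).symm y) X) =
      covD (chartMetric g c) (chartRep E ι p c) (pushField (chartRep E ι p c) (chartField Y p)) y
        (chartD p ((extChartAt 𝓘(ℝ, F) p).symm y) X) := by
  have hf := isMapInto_chartRep g hι p c
  have hcomp : compAlong ι p c (push ι Y) =ᶠ[𝓝 y]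
      pushField (chartRep E ι p c) (chartField Y p) := by
    filter_upwards [hf.isOpen.mem_nhds hy] with z hz using compAlong_push hι Y hz
  have hpush : DifferentiableAt ℝ (pushField (chartRep E ι p c) (chartField Y p)) y :=
    ((hf.hasFDerivAt_fderiv hy).clm_apply hY.hasFDerivAt).differentiableAt
  rw [chartD_covAlong g hι hy (hpush.congr_of_eventuallyEq hcomp), covD_congr .rfl hcomp]

namespace IsNullHypersurface

theorem isHypersurface_chartRep (hι : IsNullHypersurface (F := F) g ι) {W : Set F} (hW : IsOpen W)
    (hWD : W ⊆ chartDom E ι p c) :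
    IsHypersurface (chartMetric g c) (extChartAt 𝓘(ℝ, E) c).target (chartRep E ι p c) W where
  metric := isMetricOn_chartMetric g c
  isOpen := hW
  mapsTo _ hy := (isMapInto_chartRep g hι.contMDiff p c).mapsTo (hWD hy)
  contDiffOn := (isMapInto_chartRep g hι.contMDiff p c).contDiffOn.mono hWD
  lorentz _ hy := isLorentz_chartMetric g ((extChartAt 𝓘(ℝ, E) c).map_source (hWD hy).2)
  injective _ hy := fderiv_chartRep_injective hι.contMDiff hι.injective (hWD hy)
  finrank := hι.finrank

variable {ℓ : ∀ q : N, TangentSpace 𝓘(ℝ, F) q}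

theorem isHypersurface_fieldDom (hι : IsNullHypersurface (F := F) g ι)
    (hℓ : IsNullFieldOn g ι U ℓ) (p : N) (c : M) :
    IsHypersurface (chartMetric g c) (extChartAt 𝓘(ℝ, E) c).target (chartRep E ι p c)
      (fieldDom E ι p c U ℓ) :=
  hι.isHypersurface_chartRep (isOpen_fieldDom hι.contMDiff.continuous hℓ.isOpen hℓ.smooth p c)
    fun _ hy ↦ hy.1

theorem derivTensor_eq_secondForm (hι : IsNullHypersurface (F := F) g ι)
    (hℓ : IsNullFieldOn g ι U ℓ) (hy : y ∈ fieldDom E ι p c U ℓ) (X : F) :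
    derivTensor g ι ℓ ((extChartAt 𝓘(ℝ, F) p).symm y) X X =
      -chartMetric g c (chartRep E ι p c y)
        (fderiv ℝ (chartRep E ι p c) y (chartField ℓ p y))
        (secondForm (chartMetric g c) (chartRep E ι p c) y
          (chartD p ((extChartAt 𝓘(ℝ, F) p).symm y) X)
          (chartD p ((extChartAt 𝓘(ℝ, F) p).symm y) X)) := by
  have hf := hι.isHypersurface_fieldDom hℓ p c
  have hn := isNullFieldIn_chartField hι.toIsNullImmersion hℓ p c
  rw [← hf.metric_covD_push_eq_secondForm hn hy, ← chartD_covAlong_push g hι.contMDiff hy.1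
    ((hf.contDiffAt_field hn hy).differentiableAt (by simp)), fderiv_chartRep hι.contMDiff hy.1,
    chartDsymm_chartD hy.1.1]
  exact (g.symm _ _ _).trans
    (chartMetric_chartD g (map_symm_mem_chart_source hy.1) _ _).symm

theorem isNonExpandingAt_chartField (hι : IsNullHypersurface (F := F) g ι)
    (hexp : IsNonExpanding (F := F) g ι) (hℓ : IsNullFieldOn g ι U ℓ)
    (hy : y ∈ fieldDom E ι p c U ℓ) :
    IsNonExpandingAt (chartMetric g c) (chartRep E ι p c) (chartField ℓ p) y := by
  set q := (extChartAt 𝓘(ℝ, F) p).symm y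
  obtain ⟨U', ℓ', hℓ', hqU', hℓ'q, hθ⟩ := hexp q
  obtain ⟨e, he, hsum⟩ : ∃ e : Fin (Module.finrank ℝ F - 1) → F,
    (∀ A B, inducedForm g ι q (e A) (e B) = if A = B then 1 else 0) ∧
    ∑ A, derivTensor g ι ℓ' q (e A) (e A) = 0 := hθ
  have hy' : y ∈ fieldDom E ι p c U' ℓ' := mem_fieldDom hy.1 hqU' hℓ'q
  obtain ⟨r, hr⟩ := (hι.isHypersurface_fieldDom hℓ' p c).exists_eq_smul_of_null
    (isNullFieldIn_chartField hι.toIsNullImmersion hℓ' p c) hy'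
    ((isNullFieldIn_chartField hι.toIsNullImmersion hℓ p c).null y hy _)
  refine ⟨fun A ↦ chartD p q (e A), fun A B ↦ ?_, ?_⟩
  · rw [metric_chartRep g hι.contMDiff hy.1, chartDsymm_chartD hy.1.1, chartDsymm_chartD hy.1.1, he]
  · rw [Finset.sum_congr rfl fun A _ ↦ derivTensor_eq_secondForm hι hℓ' hy' (e A),
      Finset.sum_neg_distrib, neg_eq_zero] at hsum
    simp only [hr, map_smul, smul_apply, ← Finset.smul_sum]
    exact (congrArg _ hsum).trans (smul_zero r)

end IsNullHypersurface

variable {Λ : ℝ} {T : ∀ x : M, TangentSpace 𝓘(ℝ, E) x →L[ℝ] TangentSpace 𝓘(ℝ, E) x →L[ℝ] ℝ}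

/-- The energy-momentum tensor at `x` as a bilinear form on the model space. -/
def stressForm (T : ∀ x : M, TangentSpace 𝓘(ℝ, E) x →L[ℝ] TangentSpace 𝓘(ℝ, E) x →L[ℝ] ℝ)
    (x : M) : E →L[ℝ] E →L[ℝ] ℝ := T x

theorem ricci_eq_ricciAt (g : LorentzMetric E M) (x : M) (v w : E) :
    ricci g x v w = ricciAt (chartMetric g x) (extChartAt 𝓘(ℝ, E) x x) v w := by
  change ricciAt (chartMetric g x) (extChartAt 𝓘(ℝ, E) x x) (chartD x x v) (chartD x x w) = _
  rw [chartD_self, chartD_self]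

theorem ricciAt_eq_stressForm {x : M} (hEin : einstein g x = -(Λ • g.val x) + T x) {v w : E}
    (hvw : g.form x v w = 0) :
    ricciAt (chartMetric g x) (extChartAt 𝓘(ℝ, E) x x) v w = stressForm T x v w := by
  have happly : ricci g x v w - (scalarCurvature g x / 2) * g.form x v w =
      -(Λ * g.form x v w) + stressForm T x v w := congrArg (fun b ↦ b v w) hEin
  rw [← ricci_eq_ricciAt]
  linarith [hvw ▸ happly]

/-- `ι` is totally geodesic: its second fundamental form takes values in the tangent spaces. It is
evaluated in the charts at `p` and at `ι p`. -/
def IsTotallyGeodesic (g : LorentzMetric E M) (ι : N → M) : Prop :=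
  ∀ (p : N) (X Y : F), ∃ Z : F, mapD E F ι p Z =
    secondForm (chartMetric g (ι p)) (chartRep E ι p (ι p)) (extChartAt 𝓘(ℝ, F) p p) X Y

theorem IsNullHypersurface.isTotallyGeodesic [FiniteDimensional ℝ F]
    (hι : IsNullHypersurface (F := F) g ι) (hexp : IsNonExpanding (F := F) g ι)
    (hEin : EinsteinOn g ι Λ T) (hT : NullEnergyCondition (F := F) g ι T) :
    IsTotallyGeodesic (F := F) g ι := by
  intro p X Y
  obtain ⟨U, ℓ, hℓ, hpU, hℓp, -⟩ := hexp p
  have hf := hι.isHypersurface_fieldDom hℓ p (ι p)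
  have hn := isNullFieldIn_chartField hι.toIsNullImmersion hℓ p (ι p)
  have hy := mem_fieldDom_self (E := E) ι hpU hℓp
  have hpush := fderiv_chartRep_chartField_self hι.contMDiff ℓ p
  have hRic : 0 ≤ ricciAt (chartMetric g (ι p)) (chartRep E ι p (ι p) (extChartAt 𝓘(ℝ, F) p p))
      (mapD E F ι p (ℓ p)) (mapD E F ι p (ℓ p)) := by
    rw [chartRep_self]
    exact (hT p (ℓ p) (hℓ.null p hpU)).trans_eq
      (ricciAt_eq_stressForm (hEin p) (hℓ.null p hpU)).symm
  obtain ⟨Z, hZ⟩ := hf.exists_push_eq_of_orthogonal hn hy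
    (hf.metric_secondForm_eq_zero hn hy (by
      filter_upwards [hf.isOpen.mem_nhds hy] with z hz
        using hι.isNonExpandingAt_chartField hexp hℓ hz) (hpush ▸ hRic) X Y)
  exact ⟨Z, (fderiv_chartRep_self hι.contMDiff p Z).symm.trans hZ⟩

end NullHypersurfaceCharts

section RotationPotential

variable {E : Type*} [NormedAddCommGroup E] [NormedSpace ℝ E]
  {M : Type*} [TopologicalSpace M] [ChartedSpace E M] [IsManifold 𝓘(ℝ, E) ∞ M]
  {F : Type*} [NormedAddCommGroup F] [NormedSpace ℝ F]
  {N : Type*} [TopologicalSpace N] [ChartedSpace F N]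
  {g : LorentzMetric E M} {ι : N → M} {U : Set N} {p : N}

/-- The value of a 1-form as a functional on the model space. -/
def oneFormAt (α : ∀ q : N, TangentSpace 𝓘(ℝ, F) q →L[ℝ] ℝ) (q : N) : F →L[ℝ] ℝ := α q

theorem chartOneForm_apply (α : ∀ q : N, TangentSpace 𝓘(ℝ, F) q →L[ℝ] ℝ) (c : N) (y X : F) :
    chartOneForm α c y X = oneFormAt α ((extChartAt 𝓘(ℝ, F) c).symm y) (chartDsymm c y X) :=
  rfl

variable [IsManifold 𝓘(ℝ, F) ∞ N]

theorem differentiableAt_chartField (hU : IsOpen U) {Y : ∀ q : N, TangentSpace 𝓘(ℝ, F) q}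
    (hY : IsSmoothFieldOn U Y) (hp : p ∈ U) :
    DifferentiableAt ℝ (chartField Y p) (extChartAt 𝓘(ℝ, F) p p) := by
  refine ((contDiffOn_chartField hU hY p).contDiffAt ((isOpen_preimage_chart p hU).mem_nhds
    ⟨mem_extChartAt_target p, ?_⟩)).differentiableAt (by simp)
  rwa [Set.mem_preimage, extChartAt_to_inv]

variable [FiniteDimensional ℝ E]

theorem covAlong_push_self (hι : ContMDiff 𝓘(ℝ, F) 𝓘(ℝ, E) ∞ ι)
    {Y : ∀ q : N, TangentSpace 𝓘(ℝ, F) q}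
    (hY : DifferentiableAt ℝ (chartField Y p) (extChartAt 𝓘(ℝ, F) p p)) (X : F) :
    covAlong g ι (push ι Y) p X =
      covD (chartMetric g (ι p)) (chartRep E ι p (ι p))
        (pushField (chartRep E ι p (ι p)) (chartField Y p)) (extChartAt 𝓘(ℝ, F) p p) X := by
  have h := chartD_covAlong_push g hι (mem_chartDom_self ι p) hY
  rw [extChartAt_to_inv] at h
  exact (chartD_self (E := E) (ι p) _).symm.trans ((h X).trans (congrArg _ (chartD_self p X)))

theorem mapD_inducedDeriv (hι : ContMDiff 𝓘(ℝ, F) 𝓘(ℝ, E) ∞ ι)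
    (htg : IsTotallyGeodesic (F := F) g ι) {Y : ∀ q : N, TangentSpace 𝓘(ℝ, F) q}
    (hY : DifferentiableAt ℝ (chartField Y p) (extChartAt 𝓘(ℝ, F) p p)) (X : F) :
    mapD E F ι p (inducedDeriv g ι Y p X) = covAlong g ι (push ι Y) p X := by
  obtain ⟨Z, hZ⟩ := htg p X (chartField Y p (extChartAt 𝓘(ℝ, F) p p))
  have hex : ∃ W : F, mapD E F ι p W = covAlong g ι (push ι Y) p X := by
    refine ⟨fderiv ℝ (chartField Y p) (extChartAt 𝓘(ℝ, F) p p) X + Z, ?_⟩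
    rw [map_add, hZ, covAlong_push_self hι hY,
      (isMapInto_chartRep g hι p (ι p)).covD_pushField (mem_chartDom_self ι p) hY,
      fderiv_chartRep_self hι]
  exact Classical.epsilon_spec hex

namespace IsNullHypersurface

variable {ℓ : ∀ q : N, TangentSpace 𝓘(ℝ, F) q}

theorem inducedForm_inducedDeriv (hι : IsNullHypersurface (F := F) g ι)
    (htg : IsTotallyGeodesic (F := F) g ι) (hℓ : IsNullFieldOn g ι U ℓ) (hp : p ∈ U)
    (h0 : ℓ p ≠ 0) (X Y : F) : inducedForm (F := F) g ι p (inducedDeriv g ι ℓ p X) Y = 0 := by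
  have hf := hι.isHypersurface_fieldDom hℓ p (ι p)
  have hn := isNullFieldIn_chartField hι.toIsNullImmersion hℓ p (ι p)
  have hd := differentiableAt_chartField hℓ.isOpen hℓ.smooth hp
  have hcov := hf.metric_covD_push_eq_secondForm hn (mem_fieldDom_self ι hp h0) X Y
  obtain ⟨Z, hZ⟩ := htg p X Y
  rw [← covAlong_push_self hι.contMDiff hd, ← mapD_inducedDeriv hι.contMDiff htg hd,
    chartRep_self, chartMetric_self, chartMetric_self, fderiv_chartRep_self hι.contMDiff,
    fderiv_chartRep_self hι.contMDiff, ← hZ, chartField_self] at hcov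
  have hnull : g.form (ι p) (mapD E F ι p (ℓ p)) (mapD E F ι p Z) = 0 :=
    hι.inducedForm_eq_zero (hℓ.null p hp) Z
  exact hcov.trans (neg_eq_zero.2 hnull)

theorem inducedDeriv_eq_rotationForm_smul (hι : IsNullHypersurface (F := F) g ι)
    (htg : IsTotallyGeodesic (F := F) g ι) (hℓ : IsNullFieldOn g ι U ℓ) (hp : p ∈ U)
    (h0 : ℓ p ≠ 0) (X : TangentSpace 𝓘(ℝ, F) p) :
    inducedDeriv g ι ℓ p X = rotationForm g ι ℓ p X • ℓ p := by
  have hd := differentiableAt_chartField hℓ.isOpen hℓ.smooth hp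
  have hinj : Function.Injective (mapD E F ι p) := hι.injective p
  obtain ⟨lam, hlam⟩ := SeparatingDual.exists_eq_one (R := ℝ) ((map_ne_zero_iff _ hinj).2 h0)
  have hnull (w : F) : inducedForm (F := F) g ι p (ℓ p) w = 0 :=
    hι.inducedForm_eq_zero (hℓ.null p hp) w
  have hex : ∃ α : F →L[ℝ] ℝ, ∀ X : F, inducedDeriv g ι ℓ p X = α X • ℓ p := by
    refine ⟨lam ∘L covD (chartMetric g (ι p)) (chartRep E ι p (ι p))
      (pushField (chartRep E ι p (ι p)) (chartField ℓ p)) (extChartAt 𝓘(ℝ, F) p p), fun X ↦ ?_⟩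
    obtain ⟨r, hr⟩ := hι.exists_eq_smul_of_null h0 hnull
      (hι.inducedForm_inducedDeriv htg hℓ hp h0 X (inducedDeriv g ι ℓ p X))
    have hpush : mapD E F ι p (inducedDeriv g ι ℓ p X) = r • mapD E F ι p (ℓ p) :=
      (congrArg _ hr).trans ((mapD E F ι p).map_smul r (ℓ p))
    rwa [ContinuousLinearMap.comp_apply, ← covAlong_push_self hι.contMDiff hd,
      ← mapD_inducedDeriv hι.contMDiff htg hd, hpush, map_smul, hlam, smul_eq_mul, mul_one]
  exact Classical.epsilon_spec hex X

variable {c : M} {y : F}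

theorem covD_push_rotationForm (hι : IsNullHypersurface (F := F) g ι)
    (htg : IsTotallyGeodesic (F := F) g ι) (hℓ : IsNullFieldOn g ι U ℓ)
    (hy : y ∈ fieldDom E ι p c U ℓ) (X : F) :
    covD (chartMetric g c) (chartRep E ι p c) (pushField (chartRep E ι p c) (chartField ℓ p)) y X =
      chartOneForm (rotationForm g ι ℓ) p y X •
        pushField (chartRep E ι p c) (chartField ℓ p) y := by
  have hd : DifferentiableAt ℝ (chartField ℓ p) y :=
    ((hι.isHypersurface_fieldDom hℓ p c).contDiffAt_field
      (isNullFieldIn_chartField hι.toIsNullImmersion hℓ p c) hy).differentiableAt (by simp)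
  have hcov := chartD_covAlong_push g hι.contMDiff hy.1 hd (chartDsymm p y X)
  rw [chartD_chartDsymm hy.1.1] at hcov
  rw [← hcov, pushField, fderiv_chartRep hι.contMDiff hy.1, chartDsymm_chartField ℓ hy.1.1,
    chartOneForm_apply]
  have hqU := hy.2.1
  have hq0 := ne_zero_of_mem_fieldDom hy
  generalize (extChartAt 𝓘(ℝ, F) p).symm y = q at *
  have hrot : covAlong g ι (push ι ℓ) q (chartDsymm p y X) =
      oneFormAt (rotationForm g ι ℓ) q (chartDsymm p y X) • mapD E F ι q (ℓ q) :=
    ((mapD_inducedDeriv hι.contMDiff htg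
        (differentiableAt_chartField hℓ.isOpen hℓ.smooth hqU) _).symm.trans
      (congrArg (mapD E F ι q) (hι.inducedDeriv_eq_rotationForm_smul htg hℓ hqU hq0 _))).trans
      ((mapD E F ι q).map_smul _ (ℓ q))
  rw [← map_smul]
  exact congrArg (chartD (E := E) c (ι q)) hrot

theorem contDiffAt_rotationForm (hι : IsNullHypersurface (F := F) g ι)
    (htg : IsTotallyGeodesic (F := F) g ι) (hℓ : IsNullFieldOn g ι U ℓ)
    (hy : y ∈ fieldDom E ι p c U ℓ) :
    ContDiffAt ℝ ∞ (chartOneForm (rotationForm g ι ℓ) p) y := by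
  have hf := hι.isHypersurface_fieldDom hℓ p c
  have hn := isNullFieldIn_chartField hι.toIsNullImmersion hℓ p c
  set k := pushField (chartRep E ι p c) (chartField ℓ p)
  have hk : ContDiffAt ℝ ∞ k y := hf.contDiffAt_pushField hy (hf.contDiffAt_field hn hy)
  obtain ⟨lam, hlam⟩ := SeparatingDual.exists_ne_zero (R := ℝ) (hf.push_ne_zero hn hy)
  have hlamk : ContDiffAt ℝ ∞ (fun z ↦ lam (k z)) y := lam.contDiff.contDiffAt.comp y hk
  have hquot : ContDiffAt ℝ ∞ (fun z ↦ (lam (k z))⁻¹ •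
      (lam ∘L covD (chartMetric g c) (chartRep E ι p c) k z)) y :=
    (hlamk.inv hlam).smul (contDiffAt_const.clm_comp (hf.contDiffAt_covD hy hk))
  refine hquot.congr_of_eventuallyEq ?_
  filter_upwards [hf.isOpen.mem_nhds hy, hlamk.continuousAt.eventually_ne hlam] with z hz hz0
  ext X
  have hcov := congrArg lam (hι.covD_push_rotationForm htg hℓ hz X)
  rw [map_smul, smul_eq_mul] at hcov
  rw [smul_apply, ContinuousLinearMap.comp_apply, smul_eq_mul, eq_inv_mul_iff_mul_eq₀ hz0,
    mul_comm]
  exact hcov.symm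

end IsNullHypersurface

end RotationPotential

section SmoothForms

variable {F : Type*} [NormedAddCommGroup F] [NormedSpace ℝ F]
  {N : Type*} [TopologicalSpace N] [ChartedSpace F N]
  {α : ∀ q : N, TangentSpace 𝓘(ℝ, F) q →L[ℝ] ℝ}
  {β : ∀ q : N, TangentSpace 𝓘(ℝ, F) q →L[ℝ] TangentSpace 𝓘(ℝ, F) q →L[ℝ] ℝ}

/-- The value of a `(0,2)` tensor field as a bilinear form on the model space. -/
def twoTensorAt (β : ∀ q : N, TangentSpace 𝓘(ℝ, F) q →L[ℝ] TangentSpace 𝓘(ℝ, F) q →L[ℝ] ℝ)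
    (q : N) : F →L[ℝ] F →L[ℝ] ℝ := β q

theorem chartTwoTensor_apply
    (β : ∀ q : N, TangentSpace 𝓘(ℝ, F) q →L[ℝ] TangentSpace 𝓘(ℝ, F) q →L[ℝ] ℝ) (c : N)
    (y X Y : F) :
    chartTwoTensor β c y X Y =
      twoTensorAt β ((extChartAt 𝓘(ℝ, F) c).symm y) (chartDsymm c y X) (chartDsymm c y Y) :=
  rfl

/-- The exterior derivative of a 1-form at `p`, computed in the chart at `p`, as a bilinear form on
the model space. -/
def dForm (α : ∀ q : N, TangentSpace 𝓘(ℝ, F) q →L[ℝ] ℝ) (p : N) : F →L[ℝ] F →L[ℝ] ℝ :=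
  curl (chartOneForm α p) (extChartAt 𝓘(ℝ, F) p p)

variable [IsManifold 𝓘(ℝ, F) ∞ N]

theorem extDerivOneForm_eq_dForm (α : ∀ q : N, TangentSpace 𝓘(ℝ, F) q →L[ℝ] ℝ) (p : N)
    (X Y : F) : extDerivOneForm α p X Y = dForm α p X Y := by
  change curl (chartOneForm α p) (extChartAt 𝓘(ℝ, F) p p) (chartD p p X) (chartD p p Y) = _
  rw [chartD_self, chartD_self, dForm]

theorem chartOneForm_eventuallyEq (α : ∀ q : N, TangentSpace 𝓘(ℝ, F) q →L[ℝ] ℝ) {c c' : N} {y : F}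
    (hy : y ∈ chartDom F (id : N → N) c c') :
    chartOneForm α c =ᶠ[𝓝 y] fun z ↦
      chartOneForm α c' (chartRep F id c c' z) ∘L fderiv ℝ (chartRep F id c c') z := by
  filter_upwards [(isOpen_chartDom continuous_id c c').mem_nhds hy] with z hz
  ext X
  have hinv : (extChartAt 𝓘(ℝ, F) c').symm (chartRep F id c c' z) =
      (extChartAt 𝓘(ℝ, F) c).symm z := (extChartAt 𝓘(ℝ, F) c').left_inv hz.2
  rw [ContinuousLinearMap.comp_apply, fderiv_transition hz, chartOneForm_apply, chartOneForm_apply,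
    hinv]
  exact congrArg _ (chartDsymm_extChartAt_chartD (map_symm_mem_chart_source hz) _).symm

theorem curl_chartOneForm {c : N} {y : F} (hy : y ∈ (extChartAt 𝓘(ℝ, F) c).target)
    (hα : DifferentiableAt ℝ (chartOneForm α ((extChartAt 𝓘(ℝ, F) c).symm y))
      (extChartAt 𝓘(ℝ, F) ((extChartAt 𝓘(ℝ, F) c).symm y) ((extChartAt 𝓘(ℝ, F) c).symm y)))
    (X Y : F) :
    curl (chartOneForm α c) y X Y =
      dForm α ((extChartAt 𝓘(ℝ, F) c).symm y) (chartDsymm c y X) (chartDsymm c y Y) := by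
  have hyD : y ∈ chartDom F (id : N → N) c ((extChartAt 𝓘(ℝ, F) c).symm y) :=
    ⟨hy, mem_extChartAt_source _⟩
  have hcurl : curl (chartOneForm α c) y = curl _ y :=
    congrArg (fun D ↦ D - D.flip) (chartOneForm_eventuallyEq α hyD).fderiv_eq
  rw [hcurl, curl_pullback hα (contDiffAt_chartRep contMDiff_id hyD), fderiv_transition hyD,
    fderiv_transition hyD, chartD_self, chartD_self]
  rfl

theorem symmL_trivializationAt {c q : N} (hq : q ∈ (chartAt F c).source) (X : F) :
    (trivializationAt F (TangentSpace 𝓘(ℝ, F)) c).symmL ℝ q X =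
      chartDsymm c (extChartAt 𝓘(ℝ, F) c q) X := by
  have h := TangentBundle.symmL_trivializationAt (I := 𝓘(ℝ, F)) hq
  simp only [ModelWithCorners.range_eq_univ, mfderivWithin_univ] at h
  exact DFunLike.congr_fun h X

theorem isSmoothOneFormOn_of_chart {U : Set N}
    (hα : ∀ p ∈ U, ContDiffAt ℝ ∞ (chartOneForm α p) (extChartAt 𝓘(ℝ, F) p p)) :
    IsSmoothOneFormOn U α := by
  intro p hp
  refine ContMDiffAt.contMDiffWithinAt ((Bundle.contMDiffAt_section p).2 ?_)
  refine ((hα p hp).contMDiffAt.comp p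
    (contMDiffAt_extChartAt (I := 𝓘(ℝ, F)) (n := ∞))).congr_of_eventuallyEq ?_
  filter_upwards [(chartAt F p).open_source.mem_nhds (mem_chart_source F p)] with q hq
  ext X
  rw [Function.comp_apply, chartOneForm_apply, (extChartAt 𝓘(ℝ, F) p).left_inv (by simpa using hq),
    ← symmL_trivializationAt hq]
  simp only [hom_trivializationAt_apply, ContinuousLinearMap.inCoordinates,
    ContinuousLinearMap.comp_apply]
  exact DFunLike.congr_fun (Bundle.Trivial.continuousLinearMapAt_trivialization ℝ N ℝ q) _

theorem isSmoothTwoTensor_of_chart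
    (hβ : ∀ p, ContDiffAt ℝ ∞ (chartTwoTensor β p) (extChartAt 𝓘(ℝ, F) p p)) :
    IsSmoothTwoTensor β := by
  intro p
  refine (Bundle.contMDiffAt_section p).2 ?_
  refine ((hβ p).contMDiffAt.comp p
    (contMDiffAt_extChartAt (I := 𝓘(ℝ, F)) (n := ∞))).congr_of_eventuallyEq ?_
  filter_upwards [(chartAt F p).open_source.mem_nhds (mem_chart_source F p)] with q hq
  ext X Y
  rw [Function.comp_apply, chartTwoTensor_apply,
    (extChartAt 𝓘(ℝ, F) p).left_inv (by simpa using hq), ← symmL_trivializationAt hq,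
    ← symmL_trivializationAt hq]
  simp only [hom_trivializationAt_apply]
  rw [inCoordinates_apply_eq₂ hq hq (by simp)]
  refine (DFunLike.congr_fun (Bundle.Trivial.linearMapAt_trivialization ℝ N ℝ q) _).trans ?_
  have hsymm (Z : F) := (trivializationAt F (TangentSpace 𝓘(ℝ, F)) p).symmL_apply (R := ℝ) hq Z
  exact congrArg₂ (fun a b ↦ twoTensorAt β q a b) (hsymm X).symm (hsymm Y).symm

theorem lieOneForm_eq_mfderiv {ℓ : ∀ q : N, TangentSpace 𝓘(ℝ, F) q} {p : N}
    (hℓ : DifferentiableAt ℝ (chartField ℓ p) (extChartAt 𝓘(ℝ, F) p p))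
    (hα : DifferentiableAt ℝ (chartOneForm α p) (extChartAt 𝓘(ℝ, F) p p)) {X : F}
    (hzero : dForm α p (ℓ p) X = 0) :
    lieOneForm ℓ α p X = mapD ℝ F (fun q ↦ oneFormAt α q (ℓ q)) p X := by
  have hcontract : (fun q ↦ oneFormAt α q (ℓ q)) ∘ (extChartAt 𝓘(ℝ, F) p).symm
      =ᶠ[𝓝 (extChartAt 𝓘(ℝ, F) p p)] fun z ↦ chartOneForm α p z (chartField ℓ p z) := by
    filter_upwards [extChartAt_target_mem_nhds (I := 𝓘(ℝ, F)) p] with z hz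
    rw [chartOneForm_apply, chartDsymm_chartField ℓ hz, Function.comp_apply]
  have hderiv := (hα.hasFDerivAt.clm_apply hℓ.hasFDerivAt).congr_of_eventuallyEq hcontract
  have hmapD := mapD_eq_fderiv (mem_extChartAt_target p) hderiv.differentiableAt X
  rw [hderiv.fderiv, extChartAt_to_inv, chartD_self] at hmapD
  have hclosed : fderiv ℝ (chartOneForm α p) (extChartAt 𝓘(ℝ, F) p p)
      (chartField ℓ p (extChartAt 𝓘(ℝ, F) p p)) X =
      fderiv ℝ (chartOneForm α p) (extChartAt 𝓘(ℝ, F) p p) X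
        (chartField ℓ p (extChartAt 𝓘(ℝ, F) p p)) := by
    rw [chartField_self]
    exact sub_eq_zero.1 hzero
  change fderiv ℝ (chartOneForm α p) (extChartAt 𝓘(ℝ, F) p p)
      (chartField ℓ p (extChartAt 𝓘(ℝ, F) p p)) (chartD p p X) +
    chartOneForm α p (extChartAt 𝓘(ℝ, F) p p)
      (fderiv ℝ (chartField ℓ p) (extChartAt 𝓘(ℝ, F) p p) (chartD p p X)) = _
  rw [hmapD, chartD_self, hclosed, add_comm]
  rfl

end SmoothForms

section ZerothLaw

variable {E : Type*} [NormedAddCommGroup E] [NormedSpace ℝ E]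
  {M : Type*} [TopologicalSpace M] [ChartedSpace E M] [IsManifold 𝓘(ℝ, E) ∞ M]
  {F : Type*} [NormedAddCommGroup F] [NormedSpace ℝ F]
  {N : Type*} [TopologicalSpace N] [ChartedSpace F N]
  {g : LorentzMetric E M} {τ : TimeOrientation g} {ι : N → M} {Λ : ℝ}
  {T : ∀ x : M, TangentSpace 𝓘(ℝ, E) x →L[ℝ] TangentSpace 𝓘(ℝ, E) x →L[ℝ] ℝ} {p : N}

section EnergyCondition

variable [FiniteDimensional ℝ E]

theorem stressForm_eq_zero_of_future (hι : IsNullImmersion (F := F) g ι)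
    (hSEC : StrongerEnergyCondition (F := F) g τ ι T) {v : F} (hv : inducedForm g ι p v v = 0)
    (hτ : g.form (ι p) (τ.field (ι p)) (mapD E F ι p v) < 0)
    (hT : stressForm T (ι p) (mapD E F ι p v) (mapD E F ι p v) = 0) (X : F) :
    stressForm T (ι p) (mapD E F ι p v) (mapD E F ι p X) = 0 := by
  have hg := g.isLorentz (ι p)
  set k : E := mapD E F ι p v
  have hk0 : k ≠ 0 := fun h ↦ by rw [h, map_zero] at hτ; exact hτ.false
  set R : E := -((g.form (ι p)).inverse (stressForm T (ι p) k)) with hR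
  have hgR (w : E) : g.form (ι p) R w = -stressForm T (ι p) k w := by
    rw [hR, map_neg, hg.isInvertible.self_apply_inverse]
    rfl
  have hRR : g.form (ι p) R R ≤ 0 := (hSEC p v hv hτ).1
  obtain ⟨r, hr⟩ := hg.exists_eq_smul_of_null hk0 hv hRR (by rw [hg.symm, hgR, hT, neg_zero])
  have hkX : g.form (ι p) k (mapD E F ι p X) = 0 := hι.inducedForm_eq_zero hv X
  rw [← neg_eq_zero, ← hgR, hr, map_smul, smul_apply, hkX, smul_zero]

theorem stressForm_eq_zero (hι : IsNullImmersion (F := F) g ι)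
    (hSEC : StrongerEnergyCondition (F := F) g τ ι T) {v : F} (hv : inducedForm g ι p v v = 0)
    (hT : stressForm T (ι p) (mapD E F ι p v) (mapD E F ι p v) = 0) (X : F) :
    stressForm T (ι p) (mapD E F ι p v) (mapD E F ι p X) = 0 := by
  rcases eq_or_ne v 0 with rfl | hv0
  · rw [map_zero, map_zero, zero_apply]
  have hk0 : mapD E F ι p v ≠ 0 := (map_ne_zero_iff _ (hι.injective p)).2 hv0
  rcases ((g.isLorentz (ι p)).ne_zero_of_timelike_of_null hk0 hv (τ.timelike (ι p))).lt_or_gt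
    with h | h
  · exact stressForm_eq_zero_of_future hι hSEC hv h hT X
  · simpa using stressForm_eq_zero_of_future hι hSEC (v := -v) (by simpa using hv)
      (by simpa using h) (by simpa using hT) X

end EnergyCondition

variable [IsManifold 𝓘(ℝ, F) ∞ N] {U : Set N} {ℓ : ∀ q : N, TangentSpace 𝓘(ℝ, F) q}
  {Ω : ∀ q : N, TangentSpace 𝓘(ℝ, F) q →L[ℝ] TangentSpace 𝓘(ℝ, F) q →L[ℝ] ℝ}

/-- `Ω` is the rotation 2-form: the common exterior derivative of the rotation 1-form potentials of
all null fields, wherever these fields do not vanish. -/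
def IsRotationTwoForm (g : LorentzMetric E M) (ι : N → M)
    (Ω : ∀ q : N, TangentSpace 𝓘(ℝ, F) q →L[ℝ] TangentSpace 𝓘(ℝ, F) q →L[ℝ] ℝ) : Prop :=
  ∀ (U : Set N) (ℓ : ∀ q : N, TangentSpace 𝓘(ℝ, F) q), IsNullFieldOn g ι U ℓ →
    ∀ p ∈ U, ℓ p ≠ 0 → dForm (rotationForm g ι ℓ) p = twoTensorAt Ω p

theorem IsRotationTwoForm.extDerivOneForm_rotationForm (hΩ : IsRotationTwoForm g ι Ω)
    (hℓ : IsNullFieldOn g ι U ℓ) (hp : p ∈ U) (h0 : ℓ p ≠ 0) (X Y : TangentSpace 𝓘(ℝ, F) p) :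
    extDerivOneForm (rotationForm g ι ℓ) p X Y = Ω p X Y :=
  (extDerivOneForm_eq_dForm (F := F) _ p X Y).trans (congrArg (fun b : F →L[ℝ] F →L[ℝ] ℝ ↦ b X Y)
    (hΩ U ℓ hℓ p hp h0))

variable [FiniteDimensional ℝ E]

namespace IsNullHypersurface

theorem differentiableAt_rotationForm (hι : IsNullHypersurface (F := F) g ι)
    (htg : IsTotallyGeodesic (F := F) g ι) (hℓ : IsNullFieldOn g ι U ℓ) (hp : p ∈ U)
    (h0 : ℓ p ≠ 0) :
    DifferentiableAt ℝ (chartOneForm (rotationForm g ι ℓ) p) (extChartAt 𝓘(ℝ, F) p p) :=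
  (hι.contDiffAt_rotationForm htg hℓ (mem_fieldDom_self ι hp h0)).differentiableAt (by simp)

theorem riemann_rotationForm (hι : IsNullHypersurface (F := F) g ι)
    (htg : IsTotallyGeodesic (F := F) g ι) (hℓ : IsNullFieldOn g ι U ℓ) (hp : p ∈ U)
    (h0 : ℓ p ≠ 0) (X Y : F) :
    riemann (chartMetric g (ι p)) (extChartAt 𝓘(ℝ, E) (ι p) (ι p))
      (mapD E F ι p X) (mapD E F ι p Y) (mapD E F ι p (ℓ p)) =
      dForm (rotationForm g ι ℓ) p X Y • mapD E F ι p (ℓ p) := by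
  have hf := hι.isHypersurface_fieldDom hℓ p (ι p)
  have hy := mem_fieldDom_self (E := E) ι hp h0
  have h := hf.riemann_rotation hy
    (hf.contDiffAt_field (isNullFieldIn_chartField hι.toIsNullImmersion hℓ p (ι p)) hy)
    (hι.differentiableAt_rotationForm htg hℓ hp h0)
    (by filter_upwards [hf.isOpen.mem_nhds hy] with z hz
        using hι.covD_push_rotationForm htg hℓ hz) X Y
  rwa [fderiv_chartRep_chartField_self hι.contMDiff, fderiv_chartRep_self hι.contMDiff,
    fderiv_chartRep_self hι.contMDiff, chartRep_self] at h

theorem dForm_rotationForm_eq (hι : IsNullHypersurface (F := F) g ι)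
    (htg : IsTotallyGeodesic (F := F) g ι) (hℓ : IsNullFieldOn g ι U ℓ) (hp : p ∈ U)
    (h0 : ℓ p ≠ 0) {U' : Set N} {ℓ' : ∀ q : N, TangentSpace 𝓘(ℝ, F) q}
    (hℓ' : IsNullFieldOn g ι U' ℓ') (hp' : p ∈ U') (h0' : ℓ' p ≠ 0) :
    dForm (rotationForm g ι ℓ) p = dForm (rotationForm g ι ℓ') p := by
  obtain ⟨r, hr⟩ := hι.exists_eq_smul_of_null h0 (hι.inducedForm_eq_zero (hℓ.null p hp))
    (hℓ'.null p hp')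
  have hk0 : mapD E F ι p (ℓ' p) ≠ 0 := (map_ne_zero_iff _ (hι.injective p)).2 h0'
  have hk : mapD E F ι p (ℓ' p) = r • mapD E F ι p (ℓ p) :=
    (congrArg _ hr).trans ((mapD E F ι p).map_smul r (ℓ p))
  ext X Y
  refine smul_left_injective ℝ hk0 ?_
  beta_reduce
  rw [← hι.riemann_rotationForm htg hℓ' hp' h0', hk, map_smul,
    hι.riemann_rotationForm htg hℓ hp h0, smul_comm]

theorem stressForm_rotationForm [FiniteDimensional ℝ F] (hι : IsNullHypersurface (F := F) g ι)
    (htg : IsTotallyGeodesic (F := F) g ι) (hEin : EinsteinOn g ι Λ T)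
    (hℓ : IsNullFieldOn g ι U ℓ) (hp : p ∈ U) (h0 : ℓ p ≠ 0) (X : F) :
    stressForm T (ι p) (mapD E F ι p (ℓ p)) (mapD E F ι p X) =
      dForm (rotationForm g ι ℓ) p (ℓ p) X := by
  have hf := hι.isHypersurface_fieldDom hℓ p (ι p)
  have hy := mem_fieldDom_self (E := E) ι hp h0
  have hRic := hf.ricciAt_rotation (isNullFieldIn_chartField hι.toIsNullImmersion hℓ p (ι p)) hy
    (hι.differentiableAt_rotationForm htg hℓ hp h0)
    (by filter_upwards [hf.isOpen.mem_nhds hy] with z hz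
        using hι.covD_push_rotationForm htg hℓ hz) X
  have hnull : g.form (ι p) (mapD E F ι p (ℓ p)) (mapD E F ι p X) = 0 :=
    hι.inducedForm_eq_zero (hℓ.null p hp) X
  rwa [hf.metric.ricciAt_symm (hf.mapsTo hy), fderiv_chartRep_chartField_self hι.contMDiff,
    fderiv_chartRep_self hι.contMDiff, chartRep_self, chartField_self,
    ricciAt_eq_stressForm (hEin p) hnull] at hRic

theorem dForm_rotationForm_null [FiniteDimensional ℝ F] (hι : IsNullHypersurface (F := F) g ι)
    (htg : IsTotallyGeodesic (F := F) g ι) (hEin : EinsteinOn g ι Λ T)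
    (hSEC : StrongerEnergyCondition (F := F) g τ ι T) (hℓ : IsNullFieldOn g ι U ℓ) (hp : p ∈ U)
    (h0 : ℓ p ≠ 0) (X : F) : dForm (rotationForm g ι ℓ) p (ℓ p) X = 0 := by
  have hT := hι.stressForm_rotationForm htg hEin hℓ hp h0
  have hself : dForm (rotationForm g ι ℓ) p (ℓ p) (ℓ p) = 0 := curl_self (F := F) _ _ (ℓ p)
  rw [← hT]
  exact stressForm_eq_zero hι.toIsNullImmersion hSEC (hℓ.null p hp)
    ((hT (ℓ p)).trans hself) X

end IsNullHypersurface

theorem IsNullHypersurface.exists_isRotationTwoForm (hι : IsNullHypersurface (F := F) g ι)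
    (htg : IsTotallyGeodesic (F := F) g ι) (hexp : IsNonExpanding (F := F) g ι) :
    ∃ Ω : ∀ q : N, TangentSpace 𝓘(ℝ, F) q →L[ℝ] TangentSpace 𝓘(ℝ, F) q →L[ℝ] ℝ,
      IsRotationTwoForm g ι Ω := by
  choose U ℓ hℓ hp h0 _ using hexp
  exact ⟨fun p ↦ dForm (F := F) (rotationForm g ι (ℓ p)) p, fun U' ℓ' hℓ' p hp' h0' ↦
    hι.dForm_rotationForm_eq htg hℓ' hp' h0' (hℓ p) (hp p) (h0 p)⟩

namespace IsRotationTwoForm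

theorem chartTwoTensor_eq_curl (hΩ : IsRotationTwoForm g ι Ω)
    (hι : IsNullHypersurface (F := F) g ι) (htg : IsTotallyGeodesic (F := F) g ι)
    (hℓ : IsNullFieldOn g ι U ℓ) {c : M} {y : F} (hy : y ∈ fieldDom E ι p c U ℓ) :
    chartTwoTensor Ω p y = curl (chartOneForm (rotationForm g ι ℓ) p) y := by
  have h0 := ne_zero_of_mem_fieldDom hy
  ext X Y
  rw [curl_chartOneForm hy.1.1 (hι.differentiableAt_rotationForm htg hℓ hy.2.1 h0),
    hΩ U ℓ hℓ _ hy.2.1 h0, chartTwoTensor_apply]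

theorem chartTwoTensor_eventuallyEq_curl (hΩ : IsRotationTwoForm g ι Ω)
    (hι : IsNullHypersurface (F := F) g ι) (htg : IsTotallyGeodesic (F := F) g ι)
    (hℓ : IsNullFieldOn g ι U ℓ) (hp : p ∈ U) (h0 : ℓ p ≠ 0) :
    chartTwoTensor Ω p =ᶠ[𝓝 (extChartAt 𝓘(ℝ, F) p p)]
      curl (chartOneForm (rotationForm g ι ℓ) p) := by
  filter_upwards [(hι.isHypersurface_fieldDom hℓ p (ι p)).isOpen.mem_nhds
    (mem_fieldDom_self ι hp h0)] with z hz using hΩ.chartTwoTensor_eq_curl hι htg hℓ hz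

theorem isSmoothTwoTensor (hΩ : IsRotationTwoForm g ι Ω) (hι : IsNullHypersurface (F := F) g ι)
    (htg : IsTotallyGeodesic (F := F) g ι) (hexp : IsNonExpanding (F := F) g ι) :
    IsSmoothTwoTensor Ω := by
  refine isSmoothTwoTensor_of_chart fun p ↦ ?_
  obtain ⟨U, ℓ, hℓ, hp, h0, -⟩ := hexp p
  exact (contDiffAt_curl (hι.contDiffAt_rotationForm htg hℓ
    (mem_fieldDom_self ι hp h0))).congr_of_eventuallyEq
      (hΩ.chartTwoTensor_eventuallyEq_curl hι htg hℓ hp h0)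

theorem apply_null [FiniteDimensional ℝ F] (hΩ : IsRotationTwoForm g ι Ω)
    (hι : IsNullHypersurface (F := F) g ι) (htg : IsTotallyGeodesic (F := F) g ι)
    (hexp : IsNonExpanding (F := F) g ι) (hEin : EinsteinOn g ι Λ T)
    (hSEC : StrongerEnergyCondition (F := F) g τ ι T) {v : F} (hv : inducedForm g ι p v v = 0)
    (X : F) : twoTensorAt Ω p v X = 0 := by
  obtain ⟨U, ℓ, hℓ, hp, h0, -⟩ := hexp p
  obtain ⟨r, hr⟩ := hι.exists_eq_smul_of_null h0 (hι.inducedForm_eq_zero (hℓ.null p hp)) hv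
  have hnull : twoTensorAt Ω p (ℓ p) X = 0 := by
    rw [← hΩ U ℓ hℓ p hp h0, hι.dForm_rotationForm_null htg hEin hSEC hℓ hp h0]
  rw [hr]
  exact (congrArg (fun a ↦ a X) ((twoTensorAt Ω p).map_smul r (ℓ p))).trans
    ((congrArg (r • ·) hnull).trans (smul_zero r))

theorem lieTwoTensor_eq_zero (hΩ : IsRotationTwoForm g ι Ω) (hι : IsNullHypersurface (F := F) g ι)
    (htg : IsTotallyGeodesic (F := F) g ι) (hexp : IsNonExpanding (F := F) g ι)
    (hΩnull : ∀ q (v : F), inducedForm g ι q v v = 0 → ∀ X, twoTensorAt Ω q v X = 0)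
    (hℓ : IsNullFieldOn g ι U ℓ) (hp : p ∈ U) (X Y : F) : lieTwoTensor ℓ Ω p X Y = 0 := by
  obtain ⟨U', ℓ', hℓ', hp', h0, -⟩ := hexp p
  have hcurl := hΩ.chartTwoTensor_eventuallyEq_curl hι htg hℓ' hp' h0
  have hzero : ∀ᶠ z in 𝓝 (extChartAt 𝓘(ℝ, F) p p), ∀ X,
      curl (chartOneForm (rotationForm g ι ℓ') p) z (chartField ℓ p z) X = 0 := by
    filter_upwards [hcurl, (isOpen_preimage_chart p hℓ.isOpen).mem_nhds
      ⟨mem_extChartAt_target p, by rwa [Set.mem_preimage, extChartAt_to_inv]⟩] with z hz hzU X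
    rw [← hz, chartTwoTensor_apply, chartDsymm_chartField ℓ hzU.1]
    exact hΩnull _ _ (hℓ.null _ hzU.2) _
  change fderiv ℝ (chartTwoTensor Ω p) (extChartAt 𝓘(ℝ, F) p p)
      (chartField ℓ p (extChartAt 𝓘(ℝ, F) p p)) (chartD p p X) (chartD p p Y) +
    chartTwoTensor Ω p (extChartAt 𝓘(ℝ, F) p p)
      (fderiv ℝ (chartField ℓ p) (extChartAt 𝓘(ℝ, F) p p) (chartD p p X)) (chartD p p Y) +
    chartTwoTensor Ω p (extChartAt 𝓘(ℝ, F) p p) (chartD p p X)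
      (fderiv ℝ (chartField ℓ p) (extChartAt 𝓘(ℝ, F) p p) (chartD p p Y)) = 0
  rw [chartD_self, chartD_self, hcurl.fderiv_eq, hcurl.self_of_nhds]
  exact lie_curl_eq_zero (hι.contDiffAt_rotationForm htg hℓ' (mem_fieldDom_self ι hp' h0))
    (differentiableAt_chartField hℓ.isOpen hℓ.smooth hp) hzero X Y

end IsRotationTwoForm

end ZerothLaw

end NullSurface

end

theorem theorem2
    {n : ℕ} (hn : 2 < n)
    {E : Type*} [NormedAddCommGroup E] [NormedSpace ℝ E] [FiniteDimensional ℝ E]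
    (hE : Module.finrank ℝ E = n)
    {M : Type*} [TopologicalSpace M] [ChartedSpace E M] [IsManifold 𝓘(ℝ, E) ∞ M]
    {F : Type*} [NormedAddCommGroup F] [NormedSpace ℝ F] [FiniteDimensional ℝ F]
    (hF : Module.finrank ℝ F = n - 1)
    {N : Type*} [TopologicalSpace N] [ChartedSpace F N] [IsManifold 𝓘(ℝ, F) ∞ N]
    (g : NullSurface.LorentzMetric E M) (τ : NullSurface.TimeOrientation g)
    (ι : N → M) (hnull : NullSurface.IsNullImmersion (F := F) g ι)
    (hexp : NullSurface.IsNonExpanding (F := F) g ι)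
    (Λ : ℝ)
    (T : ∀ x : M, TangentSpace 𝓘(ℝ, E) x →L[ℝ] TangentSpace 𝓘(ℝ, E) x →L[ℝ] ℝ)
    (hEin : NullSurface.EinsteinOn g ι Λ T)
    (hT : NullSurface.NullEnergyCondition (F := F) g ι T)
    (hSEC : NullSurface.StrongerEnergyCondition (F := F) g τ ι T) :
    -- the covariant derivative induced on the surface is well defined
    (∀ (U : Set N) (Y : ∀ p : N, TangentSpace 𝓘(ℝ, F) p),
      IsOpen U → NullSurface.IsSmoothFieldOn U Y →
      ∀ p ∈ U, ∀ X : TangentSpace 𝓘(ℝ, F) p,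
        mfderiv 𝓘(ℝ, F) 𝓘(ℝ, E) ι p (NullSurface.inducedDeriv g ι Y p X)
          = NullSurface.covAlong g ι (NullSurface.push ι Y) p X) ∧
    -- the rotation potential of every nowhere vanishing null field exists, and the zeroth law holds
    (∀ (U : Set N) (ℓ : ∀ p : N, TangentSpace 𝓘(ℝ, F) p),
      NullSurface.IsNullFieldOn g ι U ℓ → (∀ p ∈ U, ℓ p ≠ 0) →
      NullSurface.IsSmoothOneFormOn U (NullSurface.rotationForm g ι ℓ) ∧
      ∀ p ∈ U, ∀ X : TangentSpace 𝓘(ℝ, F) p,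
        NullSurface.inducedDeriv g ι ℓ p X = NullSurface.rotationForm g ι ℓ p X • ℓ p ∧
        NullSurface.lieOneForm ℓ (NullSurface.rotationForm g ι ℓ) p X
          = mfderiv 𝓘(ℝ, F) 𝓘(ℝ, ℝ) (NullSurface.surfaceGravity g ι ℓ) p X) ∧
    -- the rotation 2-form is one and the same for all null fields, annihilated and Lie dragged by
    -- every null field
    (∃ Ω : ∀ p : N, TangentSpace 𝓘(ℝ, F) p →L[ℝ] TangentSpace 𝓘(ℝ, F) p →L[ℝ] ℝ,
      NullSurface.IsSmoothTwoTensor Ω ∧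
      (∀ (U : Set N) (ℓ : ∀ p : N, TangentSpace 𝓘(ℝ, F) p),
        NullSurface.IsNullFieldOn g ι U ℓ → (∀ p ∈ U, ℓ p ≠ 0) →
        ∀ p ∈ U, ∀ X Y : TangentSpace 𝓘(ℝ, F) p,
          NullSurface.extDerivOneForm (NullSurface.rotationForm g ι ℓ) p X Y = Ω p X Y) ∧
      (∀ (U : Set N) (ℓ : ∀ p : N, TangentSpace 𝓘(ℝ, F) p),
        NullSurface.IsNullFieldOn g ι U ℓ →
        ∀ p ∈ U, ∀ X Y : TangentSpace 𝓘(ℝ, F) p,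
          Ω p (ℓ p) X = 0 ∧ NullSurface.lieTwoTensor ℓ Ω p X Y = 0)) := by
  have hι : NullSurface.IsNullHypersurface (F := F) g ι := ⟨hnull, by omega⟩
  have htg := hι.isTotallyGeodesic hexp hEin hT
  obtain ⟨Ω, hΩ⟩ := hι.exists_isRotationTwoForm htg hexp
  have hΩnull : ∀ q (v : F), NullSurface.inducedForm g ι q v v = 0 →
      ∀ X, NullSurface.twoTensorAt Ω q v X = 0 :=
    fun _ _ hv ↦ hΩ.apply_null hι htg hexp hEin hSEC hv
  refine ⟨fun U Y hU hY p hp X ↦ ?_, fun U ℓ hℓ h0 ↦ ⟨?_, fun p hp X ↦ ⟨?_, ?_⟩⟩,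
    Ω, hΩ.isSmoothTwoTensor hι htg hexp,
    fun U ℓ hℓ h0 p hp ↦ hΩ.extDerivOneForm_rotationForm hℓ hp (h0 p hp),
    fun U ℓ hℓ p hp X Y ↦ ⟨hΩnull p (ℓ p) (hℓ.null p hp) X,
      hΩ.lieTwoTensor_eq_zero hι htg hexp hΩnull hℓ hp X Y⟩⟩
  · exact NullSurface.mapD_inducedDeriv hnull.contMDiff htg
      (NullSurface.differentiableAt_chartField hU hY hp) X
  · exact NullSurface.isSmoothOneFormOn_of_chart fun p hp ↦
      hι.contDiffAt_rotationForm htg hℓ (NullSurface.mem_fieldDom_self ι hp (h0 p hp))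
  · exact hι.inducedDeriv_eq_rotationForm_smul htg hℓ hp (h0 p hp) X
  · exact NullSurface.lieOneForm_eq_mfderiv
      (NullSurface.differentiableAt_chartField hℓ.isOpen hℓ.smooth hp)
      (hι.differentiableAt_rotationForm htg hℓ hp (h0 p hp))
      (hι.dForm_rotationForm_null htg hEin hSEC hℓ hp (h0 p hp) X)
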